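/- Consider the binary skew-symmetric broadcast channel (BSSC): input $X\in\{0,1\}$, outputs $Y_1,Y_2\in\{0,1\}$, and a channel law $q(y_1,y_2|x)$ whose marginals satisfy: if $X=0$ then $Y_1$ is uniform on $\{0,1\}$ and $Y_2=0$; if $X=1$ then $Y_1=1$ and $Y_2$ is uniform on $\{0,1\}$ (the dependence of $Y_1$ and $Y_2$ given $X$ is arbitrary). All information quantities are in bits. Marton's region is the union, over all finite alphabets and all distributions of $(U,V,W,X)$ with $(U,V,W)\to X\to(Y_1,Y_2)$ a Markov chain, of the sets of pairs $R_1,R_2\ge 0$ with $$R_1\le I(U,W;Y_1),\qquad R_2\le I(V,W;Y_2),$$ $$R_1+R_2\le I(U,W;Y_1)+I(V;Y_2|W)-I(U;V|W),\qquad R_1+R_2\le I(V,W;Y_2)+I(U;Y_1|W)-I(U;V|W).$$ For such a distribution let $SR$ be the smaller of the two right-hand sides in the last line, i.e. $SR=\min(I(W;Y_1),I(W;Y_2))+I(U;Y_1|W)+I(V;Y_2|W)-I(U;V|W)$. Then: 1. The maximum $d=\max_{p(x)}\,[I(X;Y_1)-I(X;Y_2)]$ exists and is attained exactly when $P(X=0)=x_0$,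 where $0.15843497<x_0<0.15843498$; moreover $|d-0.10072952|<5\cdot 10^{-9}$. 2. The maximum $m=\max_{p(x)}\,[I(X;Y_1)+I(X;Y_2)]$ exists and is attained exactly when $P(X=0)=\tfrac12$, and $0.6225562<m<0.6225563$. 3. For every distribution of $(U,V,W,X)$ as above, $2\,SR\le I(X;Y_1)+I(X;Y_2)+d$. 4. The maximum of $R_1+R_2$ over Marton's region exists and equals $(m+d)/2$, and $0.36164288<(m+d)/2<0.36164289$. 5. The maximum is attained with $W$ uniform on $\{0,1\}$, $P(X=0|W=0)=x_0$ and $P(X=0|W=1)=1-x_0$: for some finite-valued $U,V$ jointly distributed with this $(W,X)$, $SR=(m+d)/2$, and the constraints above admit a pair $R_1,R_2\ge0$ with $R_1+R_2=(m+d)/2$. -/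

import Mathlib

noncomputable section

/-- The law of the random variable `A` on the finite probability space with mass function `P`. -/
def law {Ω α : Type} [Fintype Ω] [DecidableEq α] (P : Ω → ℝ) (A : Ω → α) (a : α) : ℝ :=
  ∑ ω, if A ω = a then P ω else 0

/-- Shannon entropy `H(A)` in bits. -/
def entropy {Ω α : Type} [Fintype Ω] [Fintype α] [DecidableEq α]
    (P : Ω → ℝ) (A : Ω → α) : ℝ :=
  (∑ a, Real.negMulLog (law P A a)) / Real.log 2

/-- Mutual information `I(A;B)` in bits. -/
def mutualInfo {Ω α β : Type} [Fintype Ω] [Fintype α] [DecidableEq α]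
    [Fintype β] [DecidableEq β] (P : Ω → ℝ) (A : Ω → α) (B : Ω → β) : ℝ :=
  entropy P A + entropy P B - entropy P (fun ω => (A ω, B ω))

/-- Conditional mutual information `I(A;B|C)` in bits. -/
def condMutualInfo {Ω α β γ : Type} [Fintype Ω] [Fintype α] [DecidableEq α]
    [Fintype β] [DecidableEq β] [Fintype γ] [DecidableEq γ]
    (P : Ω → ℝ) (A : Ω → α) (B : Ω → β) (C : Ω → γ) : ℝ :=
  entropy P (fun ω => (A ω, C ω)) + entropy P (fun ω => (B ω, C ω))
    - entropy P C - entropy P (fun ω => (A ω, B ω, C ω))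

/-- The joint mass function of `(S, Y)` when `S` has mass function `p` and `Y` is the output of
the channel `q` (with `q x y` the probability of `y` given `x`) fed with `X = f(S)`.
Thus `S → X → Y` is a Markov chain. -/
def channelJoint {S 𝒳 𝒴 : Type} (p : S → ℝ) (f : S → 𝒳) (q : 𝒳 → 𝒴 → ℝ) : S × 𝒴 → ℝ :=
  fun ω => p ω.1 * q (f ω.1) ω.2

/-- `q` is a binary skew-symmetric broadcast channel from `X` to `(Y₁, Y₂)`: input `0` gives a
uniform `Y₁` and `Y₂ = 0`, while input `1` gives `Y₁ = 1` and a uniform `Y₂`.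
The dependence of `Y₁` and `Y₂` given `X` is arbitrary. -/
def IsBSSC (q : Fin 2 → Fin 2 × Fin 2 → ℝ) : Prop :=
  (∀ x, q x ∈ stdSimplex ℝ (Fin 2 × Fin 2)) ∧
  (∀ y, law (q 0) Prod.fst y = 1 / 2) ∧ law (q 0) Prod.snd 0 = 1 ∧
  law (q 1) Prod.fst 1 = 1 ∧ ∀ y, law (q 1) Prod.snd y = 1 / 2

section Input

variable {𝒳 𝒴₁ 𝒴₂ : Type} [Fintype 𝒳] [DecidableEq 𝒳] [Fintype 𝒴₁] [DecidableEq 𝒴₁]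
  [Fintype 𝒴₂] [DecidableEq 𝒴₂]

/-- `I(X;Y₁)` when `X` has mass function `p`. -/
def inputInfo₁ (q : 𝒳 → 𝒴₁ × 𝒴₂ → ℝ) (p : 𝒳 → ℝ) : ℝ :=
  mutualInfo (channelJoint p id q) (fun ω => ω.1) (fun ω => ω.2.1)

/-- `I(X;Y₂)` when `X` has mass function `p`. -/
def inputInfo₂ (q : 𝒳 → 𝒴₁ × 𝒴₂ → ℝ) (p : 𝒳 → ℝ) : ℝ :=
  mutualInfo (channelJoint p id q) (fun ω => ω.1) (fun ω => ω.2.2)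

end Input

section Marton

variable {𝒰 𝒱 𝒲 𝒳 𝒴₁ 𝒴₂ : Type} [Fintype 𝒰] [DecidableEq 𝒰] [Fintype 𝒱] [DecidableEq 𝒱]
  [Fintype 𝒲] [DecidableEq 𝒲] [Fintype 𝒳] [DecidableEq 𝒳] [Fintype 𝒴₁] [DecidableEq 𝒴₁]
  [Fintype 𝒴₂] [DecidableEq 𝒴₂]

/-- The joint mass function of `((U, V, W, X), (Y₁, Y₂))`, where `(U, V, W, X)` has mass
function `p` and `(U, V, W) → X → (Y₁, Y₂)` is a Markov chain through the channel `q`. -/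
def martonJoint (q : 𝒳 → 𝒴₁ × 𝒴₂ → ℝ) (p : 𝒰 × 𝒱 × 𝒲 × 𝒳 → ℝ) :
    (𝒰 × 𝒱 × 𝒲 × 𝒳) × (𝒴₁ × 𝒴₂) → ℝ :=
  channelJoint p (fun s => s.2.2.2) q

/-- `I(U,W;Y₁) + I(V;Y₂|W) - I(U;V|W)`. -/
def sumBound₁ (q : 𝒳 → 𝒴₁ × 𝒴₂ → ℝ) (p : 𝒰 × 𝒱 × 𝒲 × 𝒳 → ℝ) : ℝ :=
  mutualInfo (martonJoint q p) (fun ω => (ω.1.1, ω.1.2.2.1)) (fun ω => ω.2.1)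
    + condMutualInfo (martonJoint q p) (fun ω => ω.1.2.1) (fun ω => ω.2.2) (fun ω => ω.1.2.2.1)
    - condMutualInfo (martonJoint q p) (fun ω => ω.1.1) (fun ω => ω.1.2.1) (fun ω => ω.1.2.2.1)

/-- `I(V,W;Y₂) + I(U;Y₁|W) - I(U;V|W)`. -/
def sumBound₂ (q : 𝒳 → 𝒴₁ × 𝒴₂ → ℝ) (p : 𝒰 × 𝒱 × 𝒲 × 𝒳 → ℝ) : ℝ :=
  mutualInfo (martonJoint q p) (fun ω => (ω.1.2.1, ω.1.2.2.1)) (fun ω => ω.2.2)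
    + condMutualInfo (martonJoint q p) (fun ω => ω.1.1) (fun ω => ω.2.1) (fun ω => ω.1.2.2.1)
    - condMutualInfo (martonJoint q p) (fun ω => ω.1.1) (fun ω => ω.1.2.1) (fun ω => ω.1.2.2.1)

/-- The sum-rate `SR` of a distribution: the smaller of the two bounds on `R₁ + R₂`, that is
`min (I(W;Y₁), I(W;Y₂)) + I(U;Y₁|W) + I(V;Y₂|W) - I(U;V|W)`. -/
def martonSumRate (q : 𝒳 → 𝒴₁ × 𝒴₂ → ℝ) (p : 𝒰 × 𝒱 × 𝒲 × 𝒳 → ℝ) : ℝ :=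
  min (sumBound₁ q p) (sumBound₂ q p)

/-- The rate pairs `(R₁, R₂)` that Marton's bound gives for one distribution of
`(U, V, W, X)`. -/
def martonRates (q : 𝒳 → 𝒴₁ × 𝒴₂ → ℝ) (p : 𝒰 × 𝒱 × 𝒲 × 𝒳 → ℝ) : Set (ℝ × ℝ) :=
  {R | 0 ≤ R.1 ∧ 0 ≤ R.2 ∧
    R.1 ≤ mutualInfo (martonJoint q p) (fun ω => (ω.1.1, ω.1.2.2.1)) (fun ω => ω.2.1) ∧
    R.2 ≤ mutualInfo (martonJoint q p) (fun ω => (ω.1.2.1, ω.1.2.2.1)) (fun ω => ω.2.2) ∧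
    R.1 + R.2 ≤ sumBound₁ q p ∧ R.1 + R.2 ≤ sumBound₂ q p}

/-- Marton's inner bound: the union over all finite alphabets of `U, V, W` and all
distributions of `(U, V, W, X)`. -/
def martonRegion (q : 𝒳 → 𝒴₁ × 𝒴₂ → ℝ) : Set (ℝ × ℝ) :=
  {R | ∃ (a b c : ℕ) (p : Fin a × Fin b × Fin c × 𝒳 → ℝ),
    p ∈ stdSimplex ℝ (Fin a × Fin b × Fin c × 𝒳) ∧ R ∈ martonRates q p}

end Marton

end

/-! Write G(s,t) for `infoGap`, where s and t are the masses of X=0 and X=1. G is homogeneous of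
degree one and antisymmetric, and it vanishes on the axes and on the diagonal. It is concave on the
cone s ≤ t, hence superadditive there, and G(s,t) ≤ `gapMax`·(s+t) everywhere.

Converse: the smaller of the two sum bounds is at most their average. That average splits over the
values of W, so it is enough to treat one value of W, which is `pairGain_le`. There X is made a
function of (U,V) by enlarging U, and convexity in the weights of U, then of V, cuts both alphabets
to two symbols. For deterministic X, I(U;V|Y₁) ≥ 0 and I(U;V|Y₂) ≥ 0 bound the gain by 2ΣG(columns)
− G(total) and by G(total) − 2ΣG(rows). Of the sixteen binary patterns only the parity pattern is
delicate: averaging the two bounds leaves a cyclic sum of G over four masses, which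
`infoGap_cycle_le` controls.

Attainment: W chooses which receiver learns X. Each slice has the maximal gap in favour of that
receiver, and the mixture makes X uniform, so the bound on 2·SR and the maximum of I(X;Y₁)+I(X;Y₂)
are tight together. -/

noncomputable section

/-! ### The gap function and its derivative -/

/-- Entropy (in nats, unnormalised) of the noisy output of the skew-symmetric channel when the
mass of the input it randomises is `s` and the mass of the other input is `t`. -/
def outEnt (s t : ℝ) : ℝ := Real.negMulLog (s / 2) + Real.negMulLog (s / 2 + t)

/-- The unnormalised difference `I(X;Y₁) - I(X;Y₂)` in nats, for input masses `s` and `t`. -/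
def infoGap (s t : ℝ) : ℝ := outEnt s t - outEnt t s - (s - t) * Real.log 2

lemma negMulLog_half (s : ℝ) :
    Real.negMulLog (s / 2) = Real.negMulLog s / 2 + s / 2 * Real.log 2 := by
  rw [div_eq_mul_inv, Real.negMulLog_mul]
  simp only [Real.negMulLog, Real.log_inv]
  ring

lemma outEnt_mul (k s t : ℝ) :
    outEnt (k * s) (k * t) = k * outEnt s t + (s + t) * Real.negMulLog k := by
  unfold outEnt
  rw [mul_div_assoc, ← mul_add, Real.negMulLog_mul, Real.negMulLog_mul]
  ring

lemma infoGap_mul (k s t : ℝ) : infoGap (k * s) (k * t) = k * infoGap s t := by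
  unfold infoGap
  rw [outEnt_mul, outEnt_mul]
  ring

lemma infoGap_symm (s t : ℝ) : infoGap s t = -infoGap t s := by
  unfold infoGap; ring

@[simp] lemma infoGap_self (s : ℝ) : infoGap s s = 0 := by
  unfold infoGap; ring

@[simp] lemma infoGap_zero_left (t : ℝ) : infoGap 0 t = 0 := by
  unfold infoGap outEnt
  simp only [zero_div, zero_add, Real.negMulLog_zero, add_zero, negMulLog_half]
  ring

@[simp] lemma infoGap_zero_right (t : ℝ) : infoGap t 0 = 0 := by
  rw [infoGap_symm]; simp

lemma continuous_infoGap_one_sub : Continuous fun x : ℝ => infoGap x (1 - x) := by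
  unfold infoGap outEnt; fun_prop

lemma hasDerivAt_infoGap_one_sub {x : ℝ} (h0 : 0 < x) (h1 : x < 1) :
    HasDerivAt (fun x : ℝ => infoGap x (1 - x))
      (Real.log (1 + 2 / (x * (1 - x))) / 2 - 2 * Real.log 2) x := by
  have e : (fun x : ℝ => infoGap x (1 - x)) = fun x =>
      Real.negMulLog (x / 2) + Real.negMulLog (x / 2 + (1 - x))
        - (Real.negMulLog ((1 - x) / 2) + Real.negMulLog ((1 - x) / 2 + x))
        - (x - (1 - x)) * Real.log 2 := rfl
  rw [e]
  have i : HasDerivAt (fun x : ℝ => x) 1 x := hasDerivAt_id x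
  have i1 : HasDerivAt (fun x : ℝ => 1 - x) (-1) x := by simpa using i.const_sub 1
  have a1 := (Real.hasDerivAt_negMulLog (x := x / 2) (by positivity)).comp x (i.div_const 2)
  have j2 : HasDerivAt (fun x : ℝ => x / 2 + (1 - x)) (1 / 2 + -1) x := (i.div_const 2).add i1
  have j4 : HasDerivAt (fun x : ℝ => (1 - x) / 2 + x) (-1 / 2 + 1) x := (i1.div_const 2).add i
  have a2 := (Real.hasDerivAt_negMulLog (x := x / 2 + (1 - x)) (by linarith)).comp x j2
  have a3 := (Real.hasDerivAt_negMulLog (x := (1 - x) / 2) (by linarith)).comp x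
    (i1.div_const 2)
  have a4 := HasDerivAt.comp (h := fun x : ℝ => (1 - x) / 2 + x) x
    (Real.hasDerivAt_negMulLog (x := (1 - x) / 2 + x) (by linarith)) j4
  have a5 := (i.sub i1).mul_const (Real.log 2)
  refine (((a1.add a2).sub (a3.add a4)).sub a5).congr_deriv ?_
  have l : 1 + 2 / (x * (1 - x)) = (x / 2 + (1 - x)) * ((1 - x) / 2 + x) /
      ((x / 2) * ((1 - x) / 2)) := by
    have : 1 - x ≠ 0 := by linarith
    field_simp
    ring
  have p1 : 0 < 1 - x := by linarith
  have p2 : 0 < x / 2 + (1 - x) := by linarith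
  have p3 : 0 < (1 - x) / 2 + x := by linarith
  have p4 : 0 < x / 2 := by linarith
  have p5 : 0 < (1 - x) / 2 := by linarith
  rw [l, Real.log_div (mul_pos p2 p3).ne' (mul_pos p4 p5).ne', Real.log_mul p2.ne' p3.ne',
    Real.log_mul p4.ne' p5.ne']
  ring

/-- The derivative depends on x only through x(1-x), which increases up to 1/2. -/
lemma strictAntiOn_deriv_infoGap :
    StrictAntiOn (fun x : ℝ => Real.log (1 + 2 / (x * (1 - x))) / 2 - 2 * Real.log 2)
      (Set.Ioo 0 (1 / 2)) := by
  intro x hx y hy hxy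
  have h1 : 0 < x * (1 - x) := mul_pos hx.1 (by linarith [hx.2])
  have h2 : x * (1 - x) < y * (1 - y) := by nlinarith [hx.1, hx.2, hy.1, hy.2]
  have h3 : 2 / (y * (1 - y)) < 2 / (x * (1 - x)) := by gcongr
  have h4 : Real.log (1 + 2 / (y * (1 - y))) < Real.log (1 + 2 / (x * (1 - x))) := by
    apply Real.log_lt_log
    · have : 0 < 2 / (y * (1 - y)) := div_pos two_pos (h1.trans h2)
      linarith
    · linarith
  simp only
  linarith

lemma concaveOn_infoGap :
    ConcaveOn ℝ (Set.Icc 0 (1 / 2)) fun x : ℝ => infoGap x (1 - x) := by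
  refine (StrictAntiOn.strictConcaveOn_of_deriv (convex_Icc _ _)
    continuous_infoGap_one_sub.continuousOn ?_).concaveOn
  rw [interior_Icc]
  refine strictAntiOn_deriv_infoGap.congr fun x hx => ?_
  exact ((hasDerivAt_infoGap_one_sub hx.1 (by linarith [hx.2])).deriv).symm

/-! ### The maximiser and the maximal gap -/

/-- The input probability of `0` that maximises `I(X;Y₁) - I(X;Y₂)`. -/
def gapArg : ℝ := (15 - √105) / 30

/-- The maximum of `I(X;Y₁) - I(X;Y₂)`, in nats. -/
def gapMax : ℝ := infoGap gapArg (1 - gapArg)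

lemma gapArg_sq : 15 * gapArg ^ 2 = 15 * gapArg - 2 := by
  have : √105 ^ 2 = 105 := Real.sq_sqrt (by norm_num)
  unfold gapArg
  linear_combination this / 60

lemma gapArg_bounds : 0.158434974 < gapArg ∧ gapArg < 0.158434975 := by
  have h1 : √105 < 10.24695078 := by
    rw [Real.sqrt_lt' (by norm_num)]; norm_num
  have h2 : 10.24695075 < √105 := by
    rw [Real.lt_sqrt (by norm_num)]; norm_num
  unfold gapArg
  constructor <;> linarith

/-- At the stationary point (2-x)(1+x) = 16x(1-x). This relation between the logarithms removes
every term with coefficient x and leaves a single logarithm. -/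
lemma gapMax_eq :
    gapMax = Real.log (4 * (1 - gapArg ^ 2) / (2 - gapArg) ^ 2) / 2 := by
  obtain ⟨h0, h1⟩ := gapArg_bounds
  have hsq := gapArg_sq
  unfold gapMax infoGap outEnt
  generalize gapArg = x at *
  have e1 : x / 2 + (1 - x) = (2 - x) / 2 := by ring
  have e2 : (1 - x) / 2 + x = (1 + x) / 2 := by ring
  have p0 : x ≠ 0 := by norm_num at h0; linarith
  have p1 : 1 - x ≠ 0 := by norm_num at h1; linarith
  have p2 : 2 - x ≠ 0 := by norm_num at h1; linarith
  have p3 : 1 + x ≠ 0 := by norm_num at h0; linarith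
  have key : (2 - x) * (1 + x) = 2 ^ 4 * (x * (1 - x)) := by linear_combination hsq
  have kl := congrArg Real.log key
  rw [Real.log_mul p2 p3, Real.log_mul (by norm_num) (mul_ne_zero p0 p1), Real.log_mul p0 p1,
    Real.log_pow] at kl
  have e3 : 4 * (1 - x ^ 2) = 2 ^ 2 * ((1 - x) * (1 + x)) := by ring
  rw [e1, e2, e3, Real.log_div (by simp [*]) (by positivity), Real.log_mul (by norm_num)
    (mul_ne_zero p1 p3), Real.log_mul p1 p3, Real.log_pow, Real.log_pow]
  simp only [Real.negMulLog, Real.log_div p0 two_ne_zero, Real.log_div p1 two_ne_zero,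
    Real.log_div p2 two_ne_zero, Real.log_div p3 two_ne_zero]
  push_cast at kl ⊢
  linear_combination x / 2 * kl

lemma infoGap_lt_gapMax {x : ℝ} (h0 : 0 ≤ x) (h1 : x ≤ 1 / 2) (hx : x ≠ gapArg) :
    infoGap x (1 - x) < gapMax := by
  obtain ⟨g0, g1⟩ := gapArg_bounds
  norm_num at g0 g1
  have hg : gapArg ∈ Set.Ioo (0 : ℝ) (1 / 2) := ⟨by linarith, by linarith⟩
  -- Here x(1-x) = 2/15, so the logarithm is that of 16 and the derivative vanishes.
  have hz : Real.log (1 + 2 / (gapArg * (1 - gapArg))) / 2 - 2 * Real.log 2 = 0 := by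
    have : gapArg * (1 - gapArg) = 2 / 15 := by linear_combination - gapArg_sq / 15
    rw [this, show (1 : ℝ) + 2 / (2 / 15) = 2 ^ 4 by norm_num, Real.log_pow]
    push_cast; ring
  rcases lt_or_gt_of_ne hx with h | h
  · refine strictMonoOn_of_deriv_pos (convex_Icc 0 gapArg)
      continuous_infoGap_one_sub.continuousOn (fun y hy => ?_) ⟨h0, h.le⟩ ⟨hg.1.le, le_rfl⟩ h
    rw [interior_Icc] at hy
    rw [(hasDerivAt_infoGap_one_sub hy.1 (by linarith [hy.2, hg.2])).deriv, ← hz]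
    exact strictAntiOn_deriv_infoGap ⟨hy.1, hy.2.trans hg.2⟩ hg hy.2
  · refine strictAntiOn_of_deriv_neg (convex_Icc gapArg (1 / 2))
      continuous_infoGap_one_sub.continuousOn (fun y hy => ?_) ⟨le_rfl, hg.2.le⟩ ⟨h.le, h1⟩ h
    rw [interior_Icc] at hy
    rw [(hasDerivAt_infoGap_one_sub (hg.1.trans hy.1) (by linarith [hy.2])).deriv, ← hz]
    exact strictAntiOn_deriv_infoGap hg ⟨hg.1.trans hy.1, hy.2⟩ hy.1

lemma gapMax_pos : 0 < gapMax := by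
  have := infoGap_lt_gapMax le_rfl (by norm_num) (x := 0)
    (by have := gapArg_bounds.1; norm_num at this; linarith)
  simpa using this

/-! ### Superadditivity, monotonicity and cyclic sums of gaps -/

lemma infoGap_eq_mul {s t : ℝ} (h : s + t ≠ 0) :
    infoGap s t = (s + t) * infoGap (s / (s + t)) (1 - s / (s + t)) := by
  rw [← infoGap_mul]
  congr 1 <;> field_simp
  ring

/-- Homogeneity turns concavity of x ↦ G(x,1-x) on [0,1/2] into superadditivity on the cone s ≤ t.
-/
lemma infoGap_add_le {a b a' b' : ℝ} (ha : 0 ≤ a) (hab : a ≤ b) (ha' : 0 ≤ a') (hab' : a' ≤ b') :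
    infoGap a b + infoGap a' b' ≤ infoGap (a + a') (b + b') := by
  rcases eq_or_ne (a + b) 0 with h | h
  · obtain rfl : a = 0 := by linarith
    obtain rfl : b = 0 := by linarith
    simp
  rcases eq_or_ne (a' + b') 0 with h' | h'
  · obtain rfl : a' = 0 := by linarith
    obtain rfl : b' = 0 := by linarith
    simp
  have p : 0 < a + b := lt_of_le_of_ne (by linarith) h.symm
  have p' : 0 < a' + b' := lt_of_le_of_ne (by linarith) h'.symm
  have m : a / (a + b) ∈ Set.Icc (0 : ℝ) (1 / 2) :=
    ⟨by positivity, by rw [div_le_div_iff₀ p two_pos]; linarith⟩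
  have m' : a' / (a' + b') ∈ Set.Icc (0 : ℝ) (1 / 2) :=
    ⟨by positivity, by rw [div_le_div_iff₀ p' two_pos]; linarith⟩
  have q : 0 < a + a' + (b + b') := by linarith
  have := concaveOn_infoGap.2 m m' (div_nonneg p.le q.le) (div_nonneg p'.le q.le)
    (by field_simp; ring)
  rw [infoGap_eq_mul h, infoGap_eq_mul h', infoGap_eq_mul q.ne']
  simp only [smul_eq_mul] at this
  have e : (a + b) / (a + a' + (b + b')) * (a / (a + b)) +
      (a' + b') / (a + a' + (b + b')) * (a' / (a' + b')) = (a + a') / (a + a' + (b + b')) := by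
    field_simp
  rw [e] at this
  calc _ = (a + a' + (b + b')) * ((a + b) / (a + a' + (b + b')) *
        infoGap (a / (a + b)) (1 - a / (a + b)) + (a' + b') / (a + a' + (b + b')) *
        infoGap (a' / (a' + b')) (1 - a' / (a' + b'))) := by field_simp
    _ ≤ _ := by gcongr

/-- The increment (0, t'-t) lies in the cone and has gap zero, so superadditivity applies. -/
lemma infoGap_mono_right {s t t' : ℝ} (hs : 0 ≤ s) (h : s ≤ t) (h' : t ≤ t') :
    infoGap s t ≤ infoGap s t' := by
  simpa using infoGap_add_le hs h le_rfl (sub_nonneg.2 h')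

lemma infoGap_nonneg {s t : ℝ} (hs : 0 ≤ s) (h : s ≤ t) : 0 ≤ infoGap s t := by
  simpa using infoGap_mono_right hs le_rfl h

lemma infoGap_nonpos {s t : ℝ} (ht : 0 ≤ t) (h : t ≤ s) : infoGap s t ≤ 0 := by
  rw [infoGap_symm]; linarith [infoGap_nonneg ht h]

lemma infoGap_le {s t : ℝ} (hs : 0 ≤ s) (ht : 0 ≤ t) : infoGap s t ≤ gapMax * (s + t) := by
  rcases le_total t s with h | h
  · exact (infoGap_nonpos ht h).trans (mul_nonneg gapMax_pos.le (by linarith))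
  rcases eq_or_ne (s + t) 0 with h0 | h0
  · obtain rfl : s = 0 := by linarith
    obtain rfl : t = 0 := by linarith
    simp
  have p : 0 < s + t := lt_of_le_of_ne (by linarith) h0.symm
  rw [infoGap_eq_mul h0, mul_comm]
  gcongr
  rcases eq_or_ne (s / (s + t)) gapArg with e | e
  · rw [e]; rfl
  · exact (infoGap_lt_gapMax (by positivity)
      (by rw [div_le_div_iff₀ p two_pos]; linarith) e).le

/-- For b = (1-k)a + kc, superadditivity gives G(a,b) ≥ kG(a,c) and G(b,c) ≥ (1-k)G(a,c), since the
diagonal terms vanish. -/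
lemma infoGap_triangle {a b c : ℝ} (ha : 0 ≤ a) (hab : a ≤ b) (hbc : b ≤ c) :
    infoGap a c ≤ infoGap a b + infoGap b c := by
  rcases eq_or_lt_of_le (hab.trans hbc) with h | h
  · obtain rfl : a = b := by linarith
    simp
  obtain ⟨k, hk0, hk1, rfl⟩ : ∃ k, 0 ≤ k ∧ k ≤ 1 ∧ b = (1 - k) * a + k * c := by
    have : 0 < c - a := by linarith
    refine ⟨(b - a) / (c - a), div_nonneg (by linarith) this.le, ?_, ?_⟩
    · rw [div_le_one this]; linarith
    · field_simp; ring
  have k1 : 0 ≤ 1 - k := by linarith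
  have h1 := infoGap_add_le (mul_nonneg k1 ha) le_rfl (mul_nonneg hk0 ha)
    (mul_le_mul_of_nonneg_left h.le hk0)
  have h2 := infoGap_add_le (mul_nonneg k1 ha) (mul_le_mul_of_nonneg_left h.le k1)
    (mul_nonneg hk0 (ha.trans h.le)) le_rfl
  rw [infoGap_self, infoGap_mul] at h1 h2
  rw [show (1 - k) * a + k * a = a by ring] at h1
  rw [show (1 - k) * c + k * c = c by ring] at h2
  linarith

/-- A cyclic sum of gaps along a four-cycle with opposite minimum and maximum. -/
lemma infoGap_cycle_le {p q r s : ℝ} (hp : 0 ≤ p) (hpq : p ≤ q) (hqr : q ≤ r) (hps : p ≤ s)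
    (hsr : s ≤ r) :
    infoGap p q + infoGap q r + infoGap r s + infoGap s p ≤ gapMax * (p + q + r + s) := by
  -- The returning path r, s, p contributes at most -G(p,r) by the triangle inequality, and G(p,q) ≤
  -- G(p,r). Only G(q,r) survives.
  have h1 := infoGap_mono_right hp hpq hqr
  have h2 := infoGap_triangle hp hps hsr
  have h3 := infoGap_le (hp.trans hpq) (hp.trans (hpq.trans hqr))
  have h4 := mul_nonneg gapMax_pos.le (add_nonneg hp (hp.trans hps))
  rw [infoGap_symm r s, infoGap_symm s p]
  linarith


/-! ### Numerical value of the maximal gap -/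

lemma gapMax_bounds : 0.0698203826 < gapMax ∧ gapMax < 0.0698203829 := by
  obtain ⟨h0, h1⟩ := gapArg_bounds
  -- The quadratic equation of `gapArg` makes the argument a ratio of linear functions, so
  -- comparisons become linear in x.
  have e : 4 * (1 - gapArg ^ 2) / (2 - gapArg) ^ 2 = 4 * (17 - 15 * gapArg) / (58 - 45 * gapArg) := by
    rw [div_eq_div_iff (by nlinarith) (by linarith)]
    linear_combination (-4 * (17 - 15 * gapArg) / 15 - 4 * (58 - 45 * gapArg) / 15) * gapArg_sq
  rw [gapMax_eq, e]
  generalize gapArg = x at *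
  have hp : 0 < 58 - 45 * x := by linarith
  constructor
  -- Half the logarithm of (1+z)/(1-z) is artanh z, bounded by its odd power series. The two
  -- decimals enclose the z that gives the exact argument.
  · have l : (1 + 0.069707148) / (1 - 0.069707148) ≤ 4 * (17 - 15 * x) / (58 - 45 * x) := by
      rw [div_le_div_iff₀ (by norm_num) hp]; linarith
    have := Real.sum_range_le_log_div (x := 0.069707148) (by norm_num) (by norm_num) 4
    have := Real.log_le_log (by norm_num) l
    norm_num [Finset.sum_range_succ] at *
    linarith
  · have l : 4 * (17 - 15 * x) / (58 - 45 * x) ≤ (1 + 0.0697071482) / (1 - 0.0697071482) := by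
      rw [div_le_div_iff₀ hp (by norm_num)]; linarith
    have := Real.log_div_le_sum_range_add (x := 0.0697071482) (by norm_num) (by norm_num) 5
    have := Real.log_le_log (by apply div_pos _ hp; linarith) l
    norm_num [Finset.sum_range_succ] at *
    linarith

/-! ### Gain of a pair (U,V) for a single value of W -/

section Pairs

open Finset

/-- The part of `pairGain` contributed by one value of `U`, with joint masses `ρ` of `(V, X)`. -/
def rowGain {V : Type} [Fintype V] (ρ : V → Fin 2 → ℝ) : ℝ :=
  ∑ v, Real.negMulLog (ρ v 0 + ρ v 1) - outEnt (∑ v, ρ v 0) (∑ v, ρ v 1)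

/-- For joint masses `r` of `(U, V, X)`, the unnormalised value in nats of
`2 (I(U;Y₁) + I(V;Y₂) - I(U;V)) - I(X;Y₁) - I(X;Y₂)`. -/
def pairGain {U V : Type} [Fintype U] [Fintype V] (r : U → V → Fin 2 → ℝ) : ℝ :=
  2 * (∑ u, rowGain (r u) - ∑ v, outEnt (∑ u, r u v 1) (∑ u, r u v 0))
    + outEnt (∑ u, ∑ v, r u v 0) (∑ u, ∑ v, r u v 1)
    + outEnt (∑ u, ∑ v, r u v 1) (∑ u, ∑ v, r u v 0)
    + (∑ u, ∑ v, r u v 0 + ∑ u, ∑ v, r u v 1) * Real.log 2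

variable {I U V : Type} [Fintype I] [Fintype U] [Fintype V]

lemma rowGain_mul (k : ℝ) (ρ : V → Fin 2 → ℝ) :
    rowGain (fun v x => k * ρ v x) = k * rowGain ρ := by
  unfold rowGain
  simp only [← Finset.mul_sum, outEnt_mul, ← mul_add, Real.negMulLog_mul, Finset.sum_add_distrib,
    ← Finset.sum_mul]
  ring

/-- The skew symmetry of the channel: exchanging the receivers, with U and V, and flipping X. It
transfers statements about U to V. -/
lemma pairGain_swap (r : U → V → Fin 2 → ℝ) :
    pairGain (fun v u x => r u v (1 - x)) = pairGain r := by
  unfold pairGain rowGain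
  simp only [Finset.sum_sub_distrib, sub_zero, sub_self]
  rw [Finset.sum_comm (f := fun v u => r u v 0), Finset.sum_comm (f := fun v u => r u v 1),
    Finset.sum_comm (f := fun v u => Real.negMulLog (r u v 1 + r u v 0))]
  simp only [add_comm (r _ _ 1)]
  ring

lemma concave_outEnt {ι : Type} (s : Finset ι) (w a b : ι → ℝ) (hw : ∀ i ∈ s, 0 ≤ w i)
    (h1 : ∑ i ∈ s, w i = 1) (ha : ∀ i ∈ s, 0 ≤ a i) (hb : ∀ i ∈ s, 0 ≤ b i) :
    ∑ i ∈ s, w i * outEnt (a i) (b i) ≤ outEnt (∑ i ∈ s, w i * a i) (∑ i ∈ s, w i * b i) := by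
  have c1 := Real.concaveOn_negMulLog.le_map_sum hw h1 (p := fun i => a i / 2)
    (fun i hi => div_nonneg (ha i hi) two_pos.le)
  have c2 := Real.concaveOn_negMulLog.le_map_sum hw h1 (p := fun i => a i / 2 + b i)
    (fun i hi => add_nonneg (div_nonneg (ha i hi) two_pos.le) (hb i hi))
  simp only [smul_eq_mul] at c1 c2
  unfold outEnt
  simp only [mul_add, Finset.sum_add_distrib, Finset.sum_div, ← mul_div_assoc] at *
  linarith

/-! ### Reduction to X determined by (U,V) -/

/-- Every family of binary laws is a mixture of deterministic maps. -/
lemma exists_mixture [DecidableEq V] (ρ : V → Fin 2 → ℝ) (hρ : ∀ v x, 0 ≤ ρ v x) :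
    ∃ q : (V → Fin 2) → ℝ, (∀ g, 0 ≤ q g) ∧ ∑ g, q g = 1 ∧
      ∀ v x, (∑ g, q g * if g v = x then ρ v 0 + ρ v 1 else 0) = ρ v x := by
  -- Conditional law of X given v. The value 1/2 on null cells keeps it a probability vector.
  let t : V → Fin 2 → ℝ := fun v x =>
    if ρ v 0 + ρ v 1 = 0 then 1 / 2 else ρ v x / (ρ v 0 + ρ v 1)
  have t0 : ∀ v x, 0 ≤ t v x := fun v x => by
    have := hρ v 0; have := hρ v 1; have := hρ v x
    simp only [t]; split_ifs <;> positivity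
  have t1 : ∀ v, ∑ x, t v x = 1 := fun v => by
    simp only [t, Fin.sum_univ_two]
    split_ifs with h
    · norm_num
    · rw [← add_div, div_self h]
  have tm : ∀ v x, t v x * (ρ v 0 + ρ v 1) = ρ v x := fun v x => by
    simp only [t]
    split_ifs with h
    · have h0 := hρ v 0
      have h1 := hρ v 1
      rw [h, mul_zero]
      fin_cases x
      · simp only [Fin.zero_eta]; linarith
      · simp only [Fin.mk_one]; linarith
    · field_simp
  -- The random map takes independent values at distinct v.
  refine ⟨fun g => ∏ v, t v (g v), fun g => Finset.prod_nonneg fun v _ => t0 _ _, ?_, ?_⟩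
  · rw [← Fintype.piFinset_univ, ← Finset.prod_univ_sum]
    simp [t1]
  · intro v x
    have e : ∀ g : V → Fin 2, ((∏ v, t v (g v)) * if g v = x then ρ v 0 + ρ v 1 else 0) =
        (∏ v', if v' = v then (if g v' = x then t v' (g v') else 0) else t v' (g v')) *
          (ρ v 0 + ρ v 1) := by
      intro g
      have h : ∏ v' ∈ univ.erase v, (if v' = v then (if g v' = x then t v' (g v') else 0)
          else t v' (g v')) = ∏ v' ∈ univ.erase v, t v' (g v') :=
        Finset.prod_congr rfl fun v' hv' => if_neg (Finset.ne_of_mem_erase hv')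
      rw [← Finset.mul_prod_erase univ _ (mem_univ v),
        ← Finset.mul_prod_erase univ (fun v' => if v' = v then _ else _) (mem_univ v), h, if_pos rfl]
      split_ifs <;> ring
    simp only [e]
    rw [← Finset.sum_mul, ← Fintype.piFinset_univ,
      ← Finset.prod_univ_sum (fun _ => univ)
        (fun v' y => if v' = v then (if y = x then t v' y else 0) else t v' y),
      ← Finset.mul_prod_erase univ _ (mem_univ v)]
    rw [Finset.prod_eq_one (fun v' hv' => by simp [Finset.ne_of_mem_erase hv', t1 v'])]
    simp [tm]

/-- Every map keeps the masses of the cells, so only the entropy of (U,Y₁) changes. It is concave in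
the row and enters with a minus sign. -/
lemma rowGain_le_mixture [DecidableEq V] (ρ : V → Fin 2 → ℝ) (hρ : ∀ v x, 0 ≤ ρ v x)
    (q : (V → Fin 2) → ℝ) (hq : ∀ g, 0 ≤ q g) (h1 : ∑ g, q g = 1)
    (hm : ∀ v x, (∑ g, q g * if g v = x then ρ v 0 + ρ v 1 else 0) = ρ v x) :
    rowGain ρ ≤ ∑ g, q g * rowGain (fun v x => if g v = x then ρ v 0 + ρ v 1 else 0) := by
  have hs : ∀ x, ∑ v, ρ v x = ∑ g, q g * ∑ v, if g v = x then ρ v 0 + ρ v 1 else 0 := by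
    intro x
    simp only [Finset.mul_sum]
    rw [Finset.sum_comm]
    exact Finset.sum_congr rfl fun v _ => (hm v x).symm
  have hc := concave_outEnt univ q (fun g => ∑ v, if g v = 0 then ρ v 0 + ρ v 1 else 0)
    (fun g => ∑ v, if g v = 1 then ρ v 0 + ρ v 1 else 0) (fun g _ => hq g) h1
    (fun g _ => Finset.sum_nonneg fun v _ => by
      split_ifs
      · exact add_nonneg (hρ _ _) (hρ _ _)
      · exact le_rfl)
    (fun g _ => Finset.sum_nonneg fun v _ => by
      split_ifs
      · exact add_nonneg (hρ _ _) (hρ _ _)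
      · exact le_rfl)
  rw [← hs, ← hs] at hc
  have e : ∀ g : V → Fin 2, ∀ v, ((if g v = 0 then ρ v 0 + ρ v 1 else 0) +
      if g v = 1 then ρ v 0 + ρ v 1 else 0) = ρ v 0 + ρ v 1 := by
    intro g v
    by_cases h : g v = 0
    · simp [h]
    · have h' : g v = 1 := by omega
      simp [h']
  simp only [rowGain, e, mul_sub, Finset.sum_sub_distrib, ← Finset.sum_mul, h1, one_mul]
  linarith

/-- One may assume that `X` is a function of `(U, V)`. -/
lemma exists_deterministic [DecidableEq V] (r : U → V → Fin 2 → ℝ) (hr : ∀ u v x, 0 ≤ r u v x) :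
    ∃ r' : U × (V → Fin 2) → V → Fin 2 → ℝ, (∀ u v x, 0 ≤ r' u v x) ∧
      (∀ u v, r' u v 0 = 0 ∨ r' u v 1 = 0) ∧
      (∀ x, ∑ u, ∑ v, r' u v x = ∑ u, ∑ v, r u v x) ∧ pairGain r ≤ pairGain r' := by
  choose q hq h1 hm using fun u => exists_mixture (r u) (hr u)
  -- The random map joins U. Given U it is independent of V, so I(U;V) and the law of (V,X) stay the
  -- same while I(U;Y₁) can only grow.
  let r' : U × (V → Fin 2) → V → Fin 2 → ℝ := fun u v x =>
    q u.1 u.2 * if u.2 v = x then r u.1 v 0 + r u.1 v 1 else 0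
  have hv : ∀ v x, ∑ u, r' u v x = ∑ u, r u v x := fun v x => by
    rw [Fintype.sum_prod_type]
    exact Finset.sum_congr rfl fun u _ => hm u v x
  have hx : ∀ x, ∑ u, ∑ v, r' u v x = ∑ u, ∑ v, r u v x := fun x => by
    rw [Finset.sum_comm, Finset.sum_comm (f := fun u v => r u v x)]
    exact Finset.sum_congr rfl fun v _ => hv v x
  refine ⟨r', fun u v x => mul_nonneg (hq _ _) ?_, fun u v => ?_, hx, ?_⟩
  · split_ifs
    · exact add_nonneg (hr _ _ _) (hr _ _ _)
    · exact le_rfl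
  · by_cases h : u.2 v = 0
    · right; simp [r', h]
    · left; simp [r', h]
  · have : ∑ u, rowGain (r u) ≤ ∑ u, rowGain (r' u) := by
      rw [Fintype.sum_prod_type]
      refine Finset.sum_le_sum fun u _ => ?_
      simp only [r', rowGain_mul]
      exact rowGain_le_mixture _ (hr u) _ (hq u) (h1 u) (hm u)
    unfold pairGain
    simp only [hv, hx]
    linarith

/-! ### Reduction to two values of U -/

/-- A convex function of nonnegative weights with two fixed linear statistics is dominated by its
value at weights supported on at most two points. -/
lemma exists_sparse (A B : I → ℝ) (hA : ∀ i, 0 ≤ A i) (hB : ∀ i, 0 ≤ B i) (G : (I → ℝ) → ℝ)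
    (hG : ConvexOn ℝ {w | ∀ i, 0 ≤ w i} G) (w : I → ℝ) (hw : ∀ i, 0 ≤ w i)
    (hp : ∀ i, w i ≠ 0 → 0 < A i + B i) :
    ∃ w' : I → ℝ, (∀ i, 0 ≤ w' i) ∧ #{i | w' i ≠ 0} ≤ 2 ∧ ∑ i, w' i * A i = ∑ i, w i * A i ∧
      ∑ i, w' i * B i = ∑ i, w i * B i ∧ G w ≤ G w' := by
  classical
  induction hn : #{i | w i ≠ 0} using Nat.strong_induction_on generalizing w with
  | _ n ih =>
  subst hn
  rcases le_or_gt (#{i | w i ≠ 0}) 2 with h2 | h2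
  · exact ⟨w, hw, h2, rfl, rfl, le_rfl⟩
  -- Three or more vectors (A i, B i) in the plane are dependent. A dependence is a direction that
  -- preserves both statistics and the support.
  obtain ⟨L, hL0, hLs, hLA, hLB⟩ : ∃ L : I → ℝ, (∃ i, L i ≠ 0) ∧ (∀ i, w i = 0 → L i = 0) ∧
      ∑ i, L i * A i = 0 ∧ ∑ i, L i * B i = 0 := by
    have hdep : ¬ LinearIndependent ℝ
        (fun i : {i // i ∈ ({i | w i ≠ 0} : Finset I)} => (A i, B i)) := by
      intro h
      have := h.fintype_card_le_finrank
      simp only [Fintype.card_coe, Module.finrank_prod, Module.finrank_self] at this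
      omega
    rw [Fintype.not_linearIndependent_iff] at hdep
    obtain ⟨g, hg, i, hi⟩ := hdep
    have hsum : ∀ C : I → ℝ, (∑ i, (if h : i ∈ ({i | w i ≠ 0} : Finset I) then g ⟨i, h⟩ else 0)
        * C i) = ∑ i, g i * C i := by
      intro C
      rw [← Finset.sum_subset (Finset.subset_univ ({i | w i ≠ 0} : Finset I))
        (fun i _ h => by rw [dif_neg h, zero_mul]), ← Finset.sum_coe_sort]
      exact Finset.sum_congr rfl fun i _ => by rw [dif_pos i.2]
    refine ⟨fun i => if h : i ∈ ({i | w i ≠ 0} : Finset I) then g ⟨i, h⟩ else 0, ⟨i, ?_⟩, ?_, ?_,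
      ?_⟩
    · simp only [dif_pos i.2]; exact hi
    · intro j hj; simp [hj]
    · rw [hsum]; simpa [Prod.fst_sum] using congrArg Prod.fst hg
    · rw [hsum]; simpa [Prod.snd_sum] using congrArg Prod.snd hg
  have step : ∀ L : I → ℝ, (∃ i, L i ≠ 0) → (∀ i, w i = 0 → L i = 0) → ∑ i, L i * A i = 0 →
      ∑ i, L i * B i = 0 → ∃ t, 0 < t ∧ (∀ i, 0 ≤ w i + t * L i) ∧
        #{i | w i + t * L i ≠ 0} < #{i | w i ≠ 0} := by
    intro L hL0 hLs hLA hLB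
    -- Some entry is negative: otherwise a zero sum of L i (A i + B i), with A + B positive on the
    -- support, would force L = 0.
    have hne : ({i | L i < 0} : Finset I).Nonempty := by
      by_contra hcon
      have hpos : ∀ i, 0 ≤ L i := fun i => by
        by_contra hi
        exact hcon ⟨i, by simpa using hi⟩
      have hz : ∑ i, L i * (A i + B i) = 0 := by
        simp only [mul_add, Finset.sum_add_distrib, hLA, hLB, add_zero]
      obtain ⟨i, hi⟩ := hL0
      have := (Finset.sum_eq_zero_iff_of_nonneg fun i _ =>
        mul_nonneg (hpos i) (add_nonneg (hA i) (hB i))).1 hz i (mem_univ i)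
      rcases mul_eq_zero.1 this with h | h
      · exact hi h
      · exact (hp i fun h0 => hi (hLs i h0)).ne' h
    -- The minimal ratio marks the first weight to vanish when moving along L.
    obtain ⟨j, hj, hmin⟩ := Finset.exists_min_image _ (fun i => w i / -L i) hne
    have hLj : L j < 0 := by simpa using hj
    have hwj : 0 < w j := lt_of_le_of_ne (hw j) fun h => hLj.ne (hLs j h.symm)
    refine ⟨w j / -L j, div_pos hwj (by linarith), fun i => ?_, ?_⟩
    · rcases le_or_gt 0 (L i) with hi | hi
      · exact add_nonneg (hw i) (mul_nonneg (div_pos hwj (by linarith)).le hi)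
      · have := hmin i (by simpa using hi)
        rw [le_div_iff₀ (by linarith)] at this
        linarith
    · apply Finset.card_lt_card
      rw [Finset.ssubset_iff_of_subset]
      · refine ⟨j, by simpa using hwj.ne', ?_⟩
        have : w j / -L j * L j = -w j := by
          have := hLj.ne
          field_simp
        simp [this]
      · intro i
        simp only [mem_filter, mem_univ, true_and]
        intro h h0
        exact h (by rw [h0, hLs i h0]; ring)
  have shift : ∀ C : I → ℝ, ∀ L : I → ℝ, ∑ i, L i * C i = 0 → ∀ t,
      ∑ i, (w i + t * L i) * C i = ∑ i, w i * C i := by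
    intro C L h t
    simp only [add_mul, Finset.sum_add_distrib, mul_assoc, ← Finset.mul_sum, h, mul_zero, add_zero]
  have finish : ∀ L : I → ℝ, (∃ i, L i ≠ 0) → (∀ i, w i = 0 → L i = 0) → ∑ i, L i * A i = 0 →
      ∑ i, L i * B i = 0 → ∀ t, (∀ i, 0 ≤ w i + t * L i) →
        #{i | w i + t * L i ≠ 0} < #{i | w i ≠ 0} → G w ≤ G (fun i => w i + t * L i) →
      ∃ w' : I → ℝ, (∀ i, 0 ≤ w' i) ∧ #{i | w' i ≠ 0} ≤ 2 ∧ ∑ i, w' i * A i = ∑ i, w i * A i ∧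
      ∑ i, w' i * B i = ∑ i, w i * B i ∧ G w ≤ G w' := by
    intro L hL0 hLs hLA hLB t ht hc hGt
    obtain ⟨w', h1, h2, h3, h4, h5⟩ := ih _ hc (fun i => w i + t * L i) ht
      (fun i hi => hp i fun h0 => hi (by rw [h0, hLs i h0]; ring)) rfl
    exact ⟨w', h1, h2, h3.trans (shift A L hLA t), h4.trans (shift B L hLB t), hGt.trans h5⟩
  obtain ⟨s, hs, hs1, hs2⟩ := step L hL0 hLs hLA hLB
  have hN0 : ∃ i, (-L) i ≠ 0 := by simpa using hL0
  have hNs : ∀ i, w i = 0 → (-L) i = 0 := by simpa using hLs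
  have hNA : ∑ i, (-L) i * A i = 0 := by simpa using hLA
  have hNB : ∑ i, (-L) i * B i = 0 := by simpa using hLB
  obtain ⟨t, ht, ht1, ht2⟩ := step (-L) hN0 hNs hNA hNB
  -- w lies between the boundary points reached along L and -L, so the convex G is at least G w at
  -- one of them.
  have hmax := hG.le_max_of_mem_segment (x := fun i => w i + s * L i)
    (y := fun i => w i + t * (-L) i) (z := w) hs1 ht1 (by
      refine ⟨t / (s + t), s / (s + t), by positivity, by positivity, by field_simp; ring, ?_⟩
      ext i
      simp only [Pi.add_apply, Pi.smul_apply, smul_eq_mul, Pi.neg_apply]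
      field_simp
      ring)
  rcases le_max_iff.1 hmax with h | h
  · exact finish L hL0 hLs hLA hLB s hs1 hs2 h
  · exact finish (-L) hN0 hNs hNA hNB t ht1 ht2 h

/-- One may assume that `U` takes at most two values. -/
lemma exists_sparse_rows (r : U → V → Fin 2 → ℝ) (hr : ∀ u v x, 0 ≤ r u v x) :
    ∃ w : U → ℝ, (∀ u, 0 ≤ w u) ∧ #{u | w u ≠ 0} ≤ 2 ∧
      (∀ x, ∑ u, ∑ v, w u * r u v x = ∑ u, ∑ v, r u v x) ∧
      pairGain r ≤ pairGain fun u v x => w u * r u v x := by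
  classical
  set A : U → ℝ := fun u => ∑ v, r u v 0
  set B : U → ℝ := fun u => ∑ v, r u v 1
  have hA : ∀ u, 0 ≤ A u := fun u => Finset.sum_nonneg fun v _ => hr u v 0
  have hB : ∀ u, 0 ≤ B u := fun u => Finset.sum_nonneg fun v _ => hr u v 1
  -- With the masses of X fixed, only this part of the gain varies. It is linear in the weights
  -- minus a concave function.
  let G : (U → ℝ) → ℝ := fun w =>
    ∑ u, w u * rowGain (r u) - ∑ v, outEnt (∑ u, w u * r u v 1) (∑ u, w u * r u v 0)
  have hG : ConvexOn ℝ {w | ∀ i, 0 ≤ w i} G := by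
    refine ⟨fun w hw w' hw' a b ha hb _ i => ?_, fun w hw w' hw' a b ha hb hab => ?_⟩
    · exact add_nonneg (mul_nonneg ha (hw i)) (mul_nonneg hb (hw' i))
    have hc : ∀ v, a * outEnt (∑ u, w u * r u v 1) (∑ u, w u * r u v 0) +
        b * outEnt (∑ u, w' u * r u v 1) (∑ u, w' u * r u v 0) ≤
        outEnt (∑ u, (a * w u + b * w' u) * r u v 1) (∑ u, (a * w u + b * w' u) * r u v 0) := by
      intro v
      have nn : ∀ w : U → ℝ, (∀ i, 0 ≤ w i) → ∀ x, 0 ≤ ∑ u, w u * r u v x := fun w hw x =>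
        Finset.sum_nonneg fun u _ => mul_nonneg (hw u) (hr u v x)
      have := concave_outEnt univ ![a, b] ![∑ u, w u * r u v 1, ∑ u, w' u * r u v 1]
        ![∑ u, w u * r u v 0, ∑ u, w' u * r u v 0]
        (by simp [Fin.forall_fin_two, ha, hb]) (by simp [hab])
        (by simpa [Fin.forall_fin_two] using ⟨nn w hw 1, nn w' hw' 1⟩)
        (by simpa [Fin.forall_fin_two] using ⟨nn w hw 0, nn w' hw' 0⟩)
      simpa [Fin.sum_univ_two, add_mul, Finset.sum_add_distrib, Finset.mul_sum, mul_assoc]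
        using this
    have hs := Finset.sum_le_sum fun v (_ : v ∈ univ) => hc v
    simp only [G, Pi.add_apply, Pi.smul_apply, smul_eq_mul, Finset.sum_add_distrib,
      ← Finset.mul_sum] at hs ⊢
    simp only [add_mul, Finset.sum_add_distrib, mul_assoc, ← Finset.mul_sum] at hs ⊢
    linarith
  -- Null rows start with weight zero, because `exists_sparse` needs positive mass on the support.
  obtain ⟨w, hw, hw2, hwA, hwB, hGw⟩ := exists_sparse A B hA hB G hG
    (fun u => if A u + B u = 0 then 0 else 1) (fun u => by split_ifs <;> norm_num)
    (fun u hu => lt_of_le_of_ne (add_nonneg (hA u) (hB u)) fun h => hu (by simp [← h]))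
  have hone : ∀ u v x, (if A u + B u = 0 then (0 : ℝ) else 1) * r u v x = r u v x := by
    intro u v x
    split_ifs with h
    · have h0 : A u = 0 := by linarith [hA u, hB u]
      have h1 : B u = 0 := by linarith [hA u, hB u]
      have h0' := (Finset.sum_eq_zero_iff_of_nonneg fun v _ => hr u v 0).1 h0 v (mem_univ v)
      have h1' := (Finset.sum_eq_zero_iff_of_nonneg fun v _ => hr u v 1).1 h1 v (mem_univ v)
      fin_cases x
      · simpa using h0'.symm
      · simpa using h1'.symm
    · rw [one_mul]
  have key : ∀ w : U → ℝ, ∑ u, rowGain (fun v x => w u * r u v x) -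
      ∑ v, outEnt (∑ u, w u * r u v 1) (∑ u, w u * r u v 0) = G w := fun w => by
    simp only [G, rowGain_mul]
  have hx : ∀ x, ∑ u, ∑ v, w u * r u v x = ∑ u, ∑ v, r u v x := by
    simp only [A, B, Finset.mul_sum, hone] at hwA hwB
    intro x
    fin_cases x
    · exact hwA
    · exact hwB
  refine ⟨w, hw, hw2, hx, ?_⟩
  have h1 := key (fun u => if A u + B u = 0 then 0 else 1)
  simp only [hone] at h1
  unfold pairGain
  rw [hx, hx, key w, h1]
  linarith

/-! ### Two bounds on the gain from conditional mutual information -/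

/-- Nonnegativity of mutual information, for unnormalised joint masses. -/
lemma negMulLog_sum_le (n : U → V → ℝ) (hn : ∀ u v, 0 ≤ n u v) :
    Real.negMulLog (∑ u, ∑ v, n u v) + ∑ u, ∑ v, Real.negMulLog (n u v) ≤
      ∑ u, Real.negMulLog (∑ v, n u v) + ∑ v, Real.negMulLog (∑ u, n u v) := by
  set R : U → ℝ := fun u => ∑ v, n u v with hR
  set C : V → ℝ := fun v => ∑ u, n u v with hC
  set T : ℝ := ∑ u, R u with hT
  have hTC : T = ∑ v, C v := Finset.sum_comm
  have hR0 : ∀ u, 0 ≤ R u := fun u => Finset.sum_nonneg fun v _ => hn u v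
  have hC0 : ∀ v, 0 ≤ C v := fun v => Finset.sum_nonneg fun u _ => hn u v
  have hT0 : 0 ≤ T := Finset.sum_nonneg fun u _ => hR0 u
  have hp : ∀ u v, Real.negMulLog (n u v) ≤ -(n u v * Real.log (R u)) - n u v * Real.log (C v)
      + n u v * Real.log T + (R u * C v / T - n u v) := by
    intro u v
    rcases (hn u v).eq_or_lt with h | h
    · rw [← h]
      simpa using div_nonneg (mul_nonneg (hR0 u) (hC0 v)) hT0
    have h1 : n u v ≤ R u := Finset.single_le_sum (fun v _ => hn u v) (mem_univ v)
    have h2 : n u v ≤ C v := Finset.single_le_sum (fun u _ => hn u v) (mem_univ u)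
    have h3 : R u ≤ T := Finset.single_le_sum (fun u _ => hR0 u) (mem_univ u)
    have p1 : 0 < R u := h.trans_le h1
    have p2 : 0 < C v := h.trans_le h2
    have p3 : 0 < T := p1.trans_le h3
    -- The inequality log z ≤ z - 1 at the ratio of the product of the marginals to the joint mass.
    have := Real.log_le_sub_one_of_pos (x := R u * C v / (T * n u v)) (by positivity)
    rw [Real.log_div (by positivity) (by positivity), Real.log_mul p1.ne' p2.ne',
      Real.log_mul p3.ne' h.ne'] at this
    have := mul_le_mul_of_nonneg_left this h.le
    have e : n u v * (R u * C v / (T * n u v) - 1) = R u * C v / T - n u v := by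
      field_simp
    rw [e] at this
    unfold Real.negMulLog
    linarith
  have hs := Finset.sum_le_sum fun u (_ : u ∈ univ) => Finset.sum_le_sum
    fun v (_ : v ∈ univ) => hp u v
  have e1 : ∑ u, ∑ v, n u v * Real.log (R u) = ∑ u, R u * Real.log (R u) := by
    simp only [hR, ← Finset.sum_mul]
  have e2 : ∑ u, ∑ v, n u v * Real.log (C v) = ∑ v, C v * Real.log (C v) := by
    rw [Finset.sum_comm]
    simp only [hC, ← Finset.sum_mul]
  have e3 : ∑ u, ∑ v, n u v * Real.log T = T * Real.log T := by
    simp only [← Finset.sum_mul]; rfl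
  have e4 : ∑ u, ∑ v, R u * C v / T = T := by
    simp only [← Finset.sum_div, ← Finset.mul_sum, ← hTC, ← Finset.sum_mul]
    rw [← hT, mul_self_div_self]
  have e5 : ∑ u, ∑ v, n u v = T := rfl
  simp only [Finset.sum_add_distrib, Finset.sum_sub_distrib, Finset.sum_neg_distrib,
    e1, e2, e3, e4, e5] at hs
  simp only [Real.negMulLog, neg_mul, Finset.sum_neg_distrib] at hs ⊢
  linarith

/-- This is I(U;V|Y₁) ≥ 0, obtained for each value of Y₁ separately. Determinism makes the entropy
of Y₁ given (U,V) equal to log 2 times the mass of X=0. -/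
lemma outEnt_sum_le (r : U → V → Fin 2 → ℝ) (hr : ∀ u v x, 0 ≤ r u v x)
    (hd : ∀ u v, r u v 0 = 0 ∨ r u v 1 = 0) :
    outEnt (∑ u, ∑ v, r u v 0) (∑ u, ∑ v, r u v 1) +
        (∑ u, ∑ v, Real.negMulLog (r u v 0 + r u v 1) + (∑ u, ∑ v, r u v 0) * Real.log 2) ≤
      ∑ u, outEnt (∑ v, r u v 0) (∑ v, r u v 1) + ∑ v, outEnt (∑ u, r u v 0) (∑ u, r u v 1) := by
  have h0 := negMulLog_sum_le (fun u v => r u v 0 / 2) fun u v => div_nonneg (hr u v 0) two_pos.le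
  have h1 := negMulLog_sum_le (fun u v => r u v 0 / 2 + r u v 1) fun u v =>
    add_nonneg (div_nonneg (hr u v 0) two_pos.le) (hr u v 1)
  have e : ∀ u v, Real.negMulLog (r u v 0 + r u v 1) + r u v 0 * Real.log 2 =
      Real.negMulLog (r u v 0 / 2) + Real.negMulLog (r u v 0 / 2 + r u v 1) := by
    intro u v
    rcases hd u v with h | h
    · simp [h]
    · simp only [h, add_zero, negMulLog_half]; ring
  have e' := Finset.sum_congr rfl fun u (_ : u ∈ univ) => Finset.sum_congr rfl
    fun v (_ : v ∈ univ) => e u v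
  simp only [outEnt, Finset.sum_add_distrib, ← Finset.sum_div, ← Finset.sum_mul] at *
  linarith

/-- I(U;V|Y₁) ≥ 0 gives I(U;Y₁) - I(U;V) ≤ I(X;Y₁) - I(V;Y₁). After substitution only gaps given V
and the total gap remain. -/
lemma pairGain_le_columns (r : U → V → Fin 2 → ℝ) (hr : ∀ u v x, 0 ≤ r u v x)
    (hd : ∀ u v, r u v 0 = 0 ∨ r u v 1 = 0) :
    pairGain r ≤ 2 * ∑ v, infoGap (∑ u, r u v 0) (∑ u, r u v 1) -
      infoGap (∑ u, ∑ v, r u v 0) (∑ u, ∑ v, r u v 1) := by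
  have h := outEnt_sum_le r hr hd
  have c0 : ∑ v, ∑ u, r u v 0 = ∑ u, ∑ v, r u v 0 := Finset.sum_comm
  have c1 : ∑ v, ∑ u, r u v 1 = ∑ u, ∑ v, r u v 1 := Finset.sum_comm
  simp only [pairGain, rowGain, infoGap, Finset.sum_sub_distrib, ← Finset.sum_mul, c0, c1]
  linarith

/-- The mirror image under `pairGain_swap`, resting on I(U;V|Y₂) ≥ 0. -/
lemma pairGain_le_rows (r : U → V → Fin 2 → ℝ) (hr : ∀ u v x, 0 ≤ r u v x)
    (hd : ∀ u v, r u v 0 = 0 ∨ r u v 1 = 0) :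
    pairGain r ≤ infoGap (∑ u, ∑ v, r u v 0) (∑ u, ∑ v, r u v 1) -
      2 * ∑ u, infoGap (∑ v, r u v 0) (∑ v, r u v 1) := by
  have h := pairGain_le_columns (fun v u x => r u v (1 - x)) (fun v u x => hr u v _)
    (fun v u => by simpa [or_comm] using hd u v)
  rw [pairGain_swap] at h
  simp only [sub_zero, sub_self] at h
  have c0 : ∑ v, ∑ u, r u v 0 = ∑ u, ∑ v, r u v 0 := Finset.sum_comm
  have c1 : ∑ v, ∑ u, r u v 1 = ∑ u, ∑ v, r u v 1 := Finset.sum_comm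
  rw [c0, c1, infoGap_symm] at h
  simp only [infoGap_symm (∑ v, r _ v 1), Finset.sum_neg_distrib] at h
  linarith

/-! ### Binary U and V -/

/-- For patterns where one value of X occupies a single cell. If x ≤ b then G(x,b) ≤ G(x,t);
otherwise G(x,b) ≤ 0 and -G(x,t) = G(t,x) is bounded. -/
lemma two_mul_infoGap_sub_le {x b t : ℝ} (hx : 0 ≤ x) (hb : 0 ≤ b) (hbt : b ≤ t) :
    2 * infoGap x b - infoGap x t ≤ gapMax * (x + t) := by
  have h1 := infoGap_le hx (hb.trans hbt)
  have h2 := infoGap_le (hb.trans hbt) hx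
  rw [infoGap_symm] at h2
  rcases le_total x b with h | h
  · linarith [infoGap_mono_right hx h hbt]
  · linarith [infoGap_nonpos hb h]

/-- The case in which `X` is the parity of `U + V`. -/
lemma le_of_xor {J a b c e : ℝ} (ha : 0 ≤ a) (hb : 0 ≤ b) (hc : 0 ≤ c) (he : 0 ≤ e)
    (hV : J ≤ 2 * (infoGap a e + infoGap b c) - infoGap (a + b) (e + c))
    (hU : J ≤ infoGap (a + b) (e + c) - 2 * (infoGap a c + infoGap b e)) :
    J ≤ gapMax * (a + b + (e + c)) := by
  -- The average of `hV` and `hU` is the cyclic sum G(a,e)+G(e,b)+G(b,c)+G(c,a). The cycle bound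
  -- serves orders whose minimum and maximum are opposite. When both columns or both rows are
  -- oriented alike, superadditivity or signs suffice.
  have m1 := infoGap_le (add_nonneg ha hb) (add_nonneg he hc)
  have m2 := infoGap_le (add_nonneg he hc) (add_nonneg ha hb)
  rw [infoGap_symm] at m2
  rcases le_total a e with h1 | h1 <;> rcases le_total b c with h2 | h2
  · linarith [infoGap_add_le ha h1 hb h2]
  · rcases le_total a c with h3 | h3 <;> rcases le_total b e with h4 | h4
    · linarith [infoGap_nonneg ha h3, infoGap_nonneg hb h4]
    · have := infoGap_cycle_le ha h1 h4 h3 h2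
      linarith [infoGap_symm e b, infoGap_symm c a]
    · have := infoGap_cycle_le hc h3 h1 h2 h4
      linarith [infoGap_symm e b, infoGap_symm c a]
    · have := infoGap_add_le he h4 hc h3
      rw [infoGap_symm e b, infoGap_symm c a, infoGap_symm (e + c), add_comm b a] at this
      linarith
  · rcases le_total a c with h3 | h3 <;> rcases le_total b e with h4 | h4
    · linarith [infoGap_nonneg ha h3, infoGap_nonneg hb h4]
    · have := infoGap_cycle_le he h4 h2 h1 h3
      linarith [infoGap_symm e b, infoGap_symm c a]
    · have := infoGap_cycle_le hb h2 h3 h4 h1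
      linarith [infoGap_symm e b, infoGap_symm c a]
    · have := infoGap_add_le he h4 hc h3
      rw [infoGap_symm e b, infoGap_symm c a, infoGap_symm (e + c), add_comm b a] at this
      linarith
  · linarith [infoGap_nonpos he h1, infoGap_nonpos hc h2]

/-- The bound for binary `U` and `V`, where `aᵢⱼ` and `bᵢⱼ` are the masses of `X = 0` and `X = 1`
on the cell `(U, V) = (i, j)`. -/
lemma le_of_two_by_two {J a₀₀ a₀₁ a₁₀ a₁₁ b₀₀ b₀₁ b₁₀ b₁₁ : ℝ}
    (ha₀₀ : 0 ≤ a₀₀) (ha₀₁ : 0 ≤ a₀₁) (ha₁₀ : 0 ≤ a₁₀) (ha₁₁ : 0 ≤ a₁₁)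
    (hb₀₀ : 0 ≤ b₀₀) (hb₀₁ : 0 ≤ b₀₁) (hb₁₀ : 0 ≤ b₁₀) (hb₁₁ : 0 ≤ b₁₁)
    (h₀₀ : a₀₀ = 0 ∨ b₀₀ = 0) (h₀₁ : a₀₁ = 0 ∨ b₀₁ = 0) (h₁₀ : a₁₀ = 0 ∨ b₁₀ = 0)
    (h₁₁ : a₁₁ = 0 ∨ b₁₁ = 0)
    (hV : J ≤ 2 * (infoGap (a₀₀ + a₁₀) (b₀₀ + b₁₀) + infoGap (a₀₁ + a₁₁) (b₀₁ + b₁₁)) -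
      infoGap (a₀₀ + a₀₁ + (a₁₀ + a₁₁)) (b₀₀ + b₀₁ + (b₁₀ + b₁₁)))
    (hU : J ≤ infoGap (a₀₀ + a₀₁ + (a₁₀ + a₁₁)) (b₀₀ + b₀₁ + (b₁₀ + b₁₁)) -
      2 * (infoGap (a₀₀ + a₀₁) (b₀₀ + b₀₁) + infoGap (a₁₀ + a₁₁) (b₁₀ + b₁₁))) :
    J ≤ gapMax * (a₀₀ + a₀₁ + (a₁₀ + a₁₁) + (b₀₀ + b₀₁ + (b₁₀ + b₁₁))) := by
  have m1 := infoGap_le (s := a₀₀ + a₀₁ + (a₁₀ + a₁₁)) (t := b₀₀ + b₀₁ + (b₁₀ + b₁₁))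
    (by positivity) (by positivity)
  have m2 := infoGap_le (t := a₀₀ + a₀₁ + (a₁₀ + a₁₁)) (s := b₀₀ + b₀₁ + (b₁₀ + b₁₁))
    (by positivity) (by positivity)
  rw [infoGap_symm] at m2
  -- If X is constant or depends on U or V alone, all row gaps or all column gaps vanish and
  -- `linarith` closes. The rest are one cell against three, or parity.
  rcases h₀₀ with rfl | rfl <;> rcases h₀₁ with rfl | rfl <;> rcases h₁₀ with rfl | rfl <;>
    rcases h₁₁ with rfl | rfl <;>
    simp only [add_zero, zero_add, infoGap_zero_left, infoGap_zero_right, mul_zero, sub_zero,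
      zero_sub] at *
  · linarith
  · have := two_mul_infoGap_sub_le (x := a₁₁) (b := b₀₁) (t := b₀₀ + b₀₁ + b₁₀)
      ha₁₁ hb₀₁ (by linarith)
    linarith
  · have := two_mul_infoGap_sub_le (x := a₁₀) (b := b₀₀) (t := b₀₀ + b₀₁ + b₁₁)
      ha₁₀ hb₀₀ (by linarith)
    linarith
  · linarith
  · have := two_mul_infoGap_sub_le (x := a₀₁) (b := b₁₁) (t := b₀₀ + (b₁₀ + b₁₁))
      ha₀₁ hb₁₁ (by linarith)
    linarith
  · linarith
  · have := le_of_xor (a := a₁₀) (b := a₀₁) (c := b₁₁) (e := b₀₀) (J := J) ha₁₀ ha₀₁ hb₁₁ hb₀₀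
      (by rw [add_comm a₁₀]; linarith) (by rw [add_comm a₁₀]; linarith)
    linarith
  · have := two_mul_infoGap_sub_le (x := b₀₀) (b := a₀₁) (t := a₀₁ + (a₁₀ + a₁₁))
      hb₀₀ ha₀₁ (by linarith)
    linarith [infoGap_symm b₀₀ a₀₁, infoGap_symm b₀₀ (a₀₁ + (a₁₀ + a₁₁))]
  · have := two_mul_infoGap_sub_le (x := a₀₀) (b := b₁₀) (t := b₀₁ + (b₁₀ + b₁₁))
      ha₀₀ hb₁₀ (by linarith)
    linarith
  · have := le_of_xor (a := a₀₀) (b := a₁₁) (c := b₀₁) (e := b₁₀) (J := J) ha₀₀ ha₁₁ hb₀₁ hb₁₀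
      (by rw [add_comm b₁₀]; linarith) (by rw [add_comm b₁₀]; linarith)
    linarith
  · linarith
  · have := two_mul_infoGap_sub_le (x := b₀₁) (b := a₀₀) (t := a₀₀ + (a₁₀ + a₁₁))
      hb₀₁ ha₀₀ (by linarith)
    linarith [infoGap_symm b₀₁ a₀₀, infoGap_symm b₀₁ (a₀₀ + (a₁₀ + a₁₁))]
  · linarith
  · have := two_mul_infoGap_sub_le (x := b₁₀) (b := a₁₁) (t := a₀₀ + a₀₁ + a₁₁)
      hb₁₀ ha₁₁ (by linarith)
    linarith [infoGap_symm b₁₀ a₁₁, infoGap_symm b₁₀ (a₀₀ + a₀₁ + a₁₁)]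
  · have := two_mul_infoGap_sub_le (x := b₁₁) (b := a₁₀) (t := a₀₀ + a₀₁ + a₁₀)
      hb₁₁ ha₁₀ (by linarith)
    linarith [infoGap_symm b₁₁ a₁₀, infoGap_symm b₁₁ (a₀₀ + a₀₁ + a₁₀)]
  · linarith

lemma exists_pair_of_card_le_two [Nontrivial I] {p : I → Prop} [DecidablePred p]
    (h : #{i | p i} ≤ 2) : ∃ i j, i ≠ j ∧ ∀ k, p k → k = i ∨ k = j := by
  classical
  obtain ⟨S, hS, hc⟩ := Finset.exists_superset_card_eq h
    (by rw [Nat.succ_le_iff]; exact Fintype.one_lt_card)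
  obtain ⟨i, j, hij, rfl⟩ := Finset.card_eq_two.1 hc
  exact ⟨i, j, hij, fun k hk => by simpa using hS (by simpa using hk)⟩

lemma sum_eq_pair {F : I → ℝ} {i j : I} (hij : i ≠ j) (h : ∀ k, k ≠ i → k ≠ j → F k = 0) :
    ∑ k, F k = F i + F j := by
  classical
  rw [← Finset.sum_pair hij]
  refine (Finset.sum_subset (Finset.subset_univ _) fun k _ hk => h k ?_ ?_).symm
  · rintro rfl; simp at hk
  · rintro rfl; simp at hk

lemma pairGain_le_of_deterministic [Nontrivial U] [Nontrivial V] (r : U → V → Fin 2 → ℝ)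
    (hr : ∀ u v x, 0 ≤ r u v x) (hd : ∀ u v, r u v 0 = 0 ∨ r u v 1 = 0) :
    pairGain r ≤ gapMax * (∑ u, ∑ v, r u v 0 + ∑ u, ∑ v, r u v 1) := by
  obtain ⟨w, hw, hw2, hwx, hwJ⟩ := exists_sparse_rows r hr
  refine hwJ.trans ?_
  rw [← hwx 0, ← hwx 1]
  have hr' : ∀ u v x, 0 ≤ w u * r u v x := fun u v x => mul_nonneg (hw u) (hr u v x)
  rw [← pairGain_swap]
  obtain ⟨z, hz, hz2, hzx, hzJ⟩ := exists_sparse_rows (fun v u x => w u * r u v (1 - x))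
    (fun v u x => hr' u v _)
  refine hzJ.trans ?_
  have e := pairGain_swap (fun v u x => z v * (w u * r u v (1 - x)))
  simp only [sub_sub_cancel] at e
  rw [← e]
  have hz0 := hzx 1
  have hz1 := hzx 0
  simp only [sub_self, sub_zero] at hz0 hz1
  rw [Finset.sum_comm, Finset.sum_comm (f := fun v u => w u * r u v 0)] at hz0
  rw [Finset.sum_comm, Finset.sum_comm (f := fun v u => w u * r u v 1)] at hz1
  rw [← hz0, ← hz1]
  have hs : ∀ u v x, 0 ≤ z v * (w u * r u v x) := fun u v x => mul_nonneg (hz v) (hr' u v x)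
  have hds : ∀ u v, z v * (w u * r u v 0) = 0 ∨ z v * (w u * r u v 1) = 0 := fun u v => by
    rcases hd u v with h | h <;> simp [h]
  obtain ⟨u₀, u₁, hu, hu'⟩ := exists_pair_of_card_le_two hw2
  obtain ⟨v₀, v₁, hv, hv'⟩ := exists_pair_of_card_le_two hz2
  have hwz : ∀ u, u ≠ u₀ → u ≠ u₁ → w u = 0 := fun u h0 h1 => by
    by_contra h; rcases hu' u h with h | h <;> contradiction
  have hzz : ∀ v, v ≠ v₀ → v ≠ v₁ → z v = 0 := fun v h0 h1 => by
    by_contra h; rcases hv' v h with h | h <;> contradiction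
  have hV := pairGain_le_columns _ hs hds
  have hU := pairGain_le_rows _ hs hds
  have su : ∀ v x, ∑ u, z v * (w u * r u v x) =
      z v * (w u₀ * r u₀ v x) + z v * (w u₁ * r u₁ v x) := fun v x =>
    sum_eq_pair hu fun u h0 h1 => by simp [hwz u h0 h1]
  have sv : ∀ u x, ∑ v, z v * (w u * r u v x) =
      z v₀ * (w u * r u v₀ x) + z v₁ * (w u * r u v₁ x) := fun u x =>
    sum_eq_pair hv fun v h0 h1 => by simp [hzz v h0 h1]
  have suv : ∀ x, ∑ u, ∑ v, z v * (w u * r u v x) =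
      z v₀ * (w u₀ * r u₀ v₀ x) + z v₁ * (w u₀ * r u₀ v₁ x) +
        (z v₀ * (w u₁ * r u₁ v₀ x) + z v₁ * (w u₁ * r u₁ v₁ x)) := fun x => by
    rw [sum_eq_pair hu fun u h0 h1 => by simp [hwz u h0 h1], sv, sv]
  rw [suv, suv] at hV hU ⊢
  simp only [su, sv] at hV hU
  rw [sum_eq_pair hv fun v h0 h1 => by simp [hzz v h0 h1]] at hV
  rw [sum_eq_pair hu fun u h0 h1 => by simp [hwz u h0 h1]] at hU
  exact le_of_two_by_two (hs _ _ _) (hs _ _ _) (hs _ _ _) (hs _ _ _) (hs _ _ _) (hs _ _ _)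
    (hs _ _ _) (hs _ _ _) (hds _ _) (hds _ _) (hds _ _) (hds _ _) hV hU

/-- For unnormalised masses `r` of `(U, V, X)`,
`2 (I(U;Y₁) + I(V;Y₂) - I(U;V)) ≤ I(X;Y₁) + I(X;Y₂) + max (I(X;Y₁) - I(X;Y₂))`. -/
theorem pairGain_le [DecidableEq V] (r : U → V → Fin 2 → ℝ) (hr : ∀ u v x, 0 ≤ r u v x) :
    pairGain r ≤ gapMax * (∑ u, ∑ v, r u v 0 + ∑ u, ∑ v, r u v 1) := by
  -- Two null symbols per alphabet guarantee two distinct values, even for an empty or one-point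
  -- alphabet.
  let s : Option (Option U) → Option (Option V) → Fin 2 → ℝ := fun u v x =>
    match u, v with
    | some (some u), some (some v) => r u v x
    | _, _ => 0
  have hs : ∀ u v x, 0 ≤ s u v x := fun u v x => by
    rcases u with _ | _ | u <;> rcases v with _ | _ | v <;> simp [s, hr]
  have e0 : ∀ x, ∑ u, ∑ v, s u v x = ∑ u, ∑ v, r u v x := fun x => by
    simp [s, Fintype.sum_option]
  have e : pairGain s = pairGain r := by
    unfold pairGain rowGain
    rw [e0, e0]
    simp [s, Fintype.sum_option, outEnt]
  obtain ⟨r', h1, h2, h3, h4⟩ := exists_deterministic s hs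
  rw [← e, ← e0, ← e0, ← h3, ← h3]
  exact h4.trans (pairGain_le_of_deterministic r' h1 h2)

end Pairs

/-! ### Entropies of the channel in closed form -/

section Evaluation

open Finset

section Laws

variable {Ω S α β : Type} [Fintype Ω] [Fintype S] [DecidableEq α] [DecidableEq β]

lemma entropy_equiv [Fintype α] [Fintype β] (P : Ω → ℝ) (A : Ω → α) (e : α ≃ β) :
    entropy P (fun ω => e (A ω)) = entropy P A := by
  unfold entropy
  rw [← e.sum_comp]
  simp [law]

lemma sum_law [Fintype α] (P : Ω → ℝ) (A : Ω → α) : ∑ a, law P A a = ∑ ω, P ω := by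
  unfold law
  rw [Finset.sum_comm]
  simp

lemma law_output {𝒴 : Type} [Fintype 𝒴] (p : S → ℝ) (f : S → Fin 2) (q : Fin 2 → 𝒴 → ℝ)
    (A : S → α) (B : 𝒴 → β) (a : α) (b : β) :
    law (channelJoint p f q) (fun ω => (A ω.1, B ω.2)) (a, b) =
      ∑ x, law p (fun s => (A s, f s)) (a, x) * law (q x) B b := by
  unfold law channelJoint
  simp only [Fintype.sum_prod_type, Prod.mk.injEq, Finset.sum_mul]
  rw [Finset.sum_comm (s := (univ : Finset (Fin 2)))]
  refine Finset.sum_congr rfl fun s _ => ?_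
  rw [Finset.sum_eq_single (f s) (fun x _ hx => by simp [hx.symm]) (by simp)]
  by_cases h : A s = a
  · simp [h, Finset.mul_sum]
  · simp [h]

lemma law_input {𝒴 : Type} [Fintype 𝒴] (p : S → ℝ) (f : S → Fin 2) (q : Fin 2 → 𝒴 → ℝ)
    (hq : ∀ x, ∑ y, q x y = 1) (A : S → α) (a : α) :
    law (channelJoint p f q) (fun ω => A ω.1) a = law p A a := by
  unfold law channelJoint
  simp only [Fintype.sum_prod_type]
  refine Finset.sum_congr rfl fun s _ => ?_
  split_ifs
  · rw [← Finset.mul_sum, hq, mul_one]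
  · simp

end Laws

namespace IsBSSC

variable {q : Fin 2 → Fin 2 × Fin 2 → ℝ} {S α : Type} [Fintype S] [Fintype α] [DecidableEq α]

lemma sum_eq_one (hq : IsBSSC q) (x : Fin 2) : ∑ y, q x y = 1 := (hq.1 x).2

lemma law_fst_one_zero (hq : IsBSSC q) : law (q 1) Prod.fst 0 = 0 := by
  have h := sum_law (q 1) Prod.fst
  rw [hq.sum_eq_one, Fin.sum_univ_two, hq.2.2.2.1] at h
  linarith

lemma law_snd_zero_one (hq : IsBSSC q) : law (q 0) Prod.snd 1 = 0 := by
  have h := sum_law (q 0) Prod.snd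
  rw [hq.sum_eq_one, Fin.sum_univ_two, hq.2.2.1] at h
  linarith

lemma entropy_input (hq : IsBSSC q) (p : S → ℝ) (f : S → Fin 2) (A : S → α) :
    entropy (channelJoint p f q) (fun ω => A ω.1) =
      (∑ a, Real.negMulLog (law p A a)) / Real.log 2 := by
  unfold entropy
  simp only [law_input p f q hq.sum_eq_one A]

lemma entropy_output₁ (hq : IsBSSC q) (p : S → ℝ) (f : S → Fin 2) (A : S → α) :
    entropy (channelJoint p f q) (fun ω => (A ω.1, ω.2.1)) =
      (∑ a, outEnt (law p (fun s => (A s, f s)) (a, 0)) (law p (fun s => (A s, f s)) (a, 1))) /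
        Real.log 2 := by
  unfold entropy
  rw [Fintype.sum_prod_type]
  simp only [law_output p f q A Prod.fst, Fin.sum_univ_two, hq.2.1, hq.2.2.2.1,
    hq.law_fst_one_zero, outEnt, mul_zero, add_zero, mul_one, mul_one_div]

lemma entropy_output₂ (hq : IsBSSC q) (p : S → ℝ) (f : S → Fin 2) (A : S → α) :
    entropy (channelJoint p f q) (fun ω => (A ω.1, ω.2.2)) =
      (∑ a, outEnt (law p (fun s => (A s, f s)) (a, 1)) (law p (fun s => (A s, f s)) (a, 0))) /
        Real.log 2 := by
  unfold entropy
  rw [Fintype.sum_prod_type]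
  simp only [law_output p f q A Prod.snd, Fin.sum_univ_two, hq.2.2.1, hq.2.2.2.2,
    hq.law_snd_zero_one, outEnt, mul_zero, zero_add, mul_one, mul_one_div]
  simp only [add_comm]

lemma entropy_fst (hq : IsBSSC q) (p : S → ℝ) (f : S → Fin 2) :
    entropy (channelJoint p f q) (fun ω => ω.2.1) =
      outEnt (law p f 0) (law p f 1) / Real.log 2 := by
  -- The output alone is the output paired with a constant.
  rw [← entropy_equiv _ _ (Equiv.punitProd (Fin 2)).symm]
  refine (hq.entropy_output₁ p f fun _ => PUnit.unit).trans ?_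
  simp [law]

lemma entropy_snd (hq : IsBSSC q) (p : S → ℝ) (f : S → Fin 2) :
    entropy (channelJoint p f q) (fun ω => ω.2.2) =
      outEnt (law p f 1) (law p f 0) / Real.log 2 := by
  rw [← entropy_equiv _ _ (Equiv.punitProd (Fin 2)).symm]
  refine (hq.entropy_output₂ p f fun _ => PUnit.unit).trans ?_
  simp [law]

lemma outEnt_zero_right (s : ℝ) : outEnt s 0 = Real.negMulLog s + s * Real.log 2 := by
  unfold outEnt
  rw [add_zero, negMulLog_half]
  ring

lemma outEnt_zero_left (s : ℝ) : outEnt 0 s = Real.negMulLog s := by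
  simp [outEnt]

lemma law_diag (p : S → ℝ) (f : S → Fin 2) (a x : Fin 2) :
    law p (fun s => (f s, f s)) (a, x) = if a = x then law p f x else 0 := by
  unfold law
  split_ifs with h
  · simp [h]
  · refine Finset.sum_eq_zero fun s _ => if_neg fun hs => h ?_
    rw [Prod.mk.injEq] at hs
    rw [← hs.1, hs.2]

lemma mutualInfo_fst (hq : IsBSSC q) (p : S → ℝ) (f : S → Fin 2) :
    mutualInfo (channelJoint p f q) (fun ω => f ω.1) (fun ω => ω.2.1) =
      (outEnt (law p f 0) (law p f 1) - law p f 0 * Real.log 2) / Real.log 2 := by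
  unfold mutualInfo
  rw [hq.entropy_input, hq.entropy_fst, hq.entropy_output₁]
  simp only [law_diag, Fin.sum_univ_two]
  norm_num [outEnt_zero_left, outEnt_zero_right]
  ring

lemma mutualInfo_snd (hq : IsBSSC q) (p : S → ℝ) (f : S → Fin 2) :
    mutualInfo (channelJoint p f q) (fun ω => f ω.1) (fun ω => ω.2.2) =
      (outEnt (law p f 1) (law p f 0) - law p f 1 * Real.log 2) / Real.log 2 := by
  unfold mutualInfo
  rw [hq.entropy_input, hq.entropy_snd, hq.entropy_output₂]
  simp only [law_diag, Fin.sum_univ_two]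
  norm_num [outEnt_zero_left, outEnt_zero_right]
  ring

lemma inputInfo₁_eq (hq : IsBSSC q) (p : Fin 2 → ℝ) :
    inputInfo₁ q p = (outEnt (p 0) (p 1) - p 0 * Real.log 2) / Real.log 2 := by
  refine (hq.mutualInfo_fst p id).trans ?_
  simp [law]

lemma inputInfo₂_eq (hq : IsBSSC q) (p : Fin 2 → ℝ) :
    inputInfo₂ q p = (outEnt (p 1) (p 0) - p 1 * Real.log 2) / Real.log 2 := by
  refine (hq.mutualInfo_snd p id).trans ?_
  simp [law]

end IsBSSC

/-! ### The sum bounds and the converse -/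

section Marton

variable {q : Fin 2 → Fin 2 × Fin 2 → ℝ} {𝒰 𝒱 𝒲 : Type} [Fintype 𝒰]
  [Fintype 𝒱] [Fintype 𝒲]

lemma law_UWX [DecidableEq 𝒰] [DecidableEq 𝒲] (p : 𝒰 × 𝒱 × 𝒲 × Fin 2 → ℝ) (u : 𝒰) (w : 𝒲) (x : Fin 2) :
    law p (fun s => ((s.1, s.2.2.1), s.2.2.2)) ((u, w), x) = ∑ v, p (u, v, w, x) := by
  simp [law, Fintype.sum_prod_type, ite_and]

lemma law_VWX [DecidableEq 𝒱] [DecidableEq 𝒲] (p : 𝒰 × 𝒱 × 𝒲 × Fin 2 → ℝ) (v : 𝒱) (w : 𝒲) (x : Fin 2) :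
    law p (fun s => ((s.2.1, s.2.2.1), s.2.2.2)) ((v, w), x) = ∑ u, p (u, v, w, x) := by
  simp [law, Fintype.sum_prod_type, ite_and]

lemma law_WX [DecidableEq 𝒲] (p : 𝒰 × 𝒱 × 𝒲 × Fin 2 → ℝ) (w : 𝒲) (x : Fin 2) :
    law p (fun s => (s.2.2.1, s.2.2.2)) (w, x) = ∑ u, ∑ v, p (u, v, w, x) := by
  simp [law, Fintype.sum_prod_type]

lemma law_X (p : 𝒰 × 𝒱 × 𝒲 × Fin 2 → ℝ) (x : Fin 2) :
    law p (fun s => s.2.2.2) x = ∑ w, ∑ u, ∑ v, p (u, v, w, x) := by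
  simp only [law, Fintype.sum_prod_type, Finset.sum_ite_eq', Finset.mem_univ, if_true]
  exact (Finset.sum_congr rfl fun u _ => Finset.sum_comm).trans Finset.sum_comm

lemma law_UVW [DecidableEq 𝒰] [DecidableEq 𝒱] [DecidableEq 𝒲] (p : 𝒰 × 𝒱 × 𝒲 × Fin 2 → ℝ) (u : 𝒰) (v : 𝒱) (w : 𝒲) :
    law p (fun s => (s.1, s.2.1, s.2.2.1)) (u, v, w) = p (u, v, w, 0) + p (u, v, w, 1) := by
  simp [law, Fintype.sum_prod_type, ite_and, Fin.sum_univ_two, Finset.sum_add_distrib]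

/-- The terms of the sum-rate that are common to its two forms, for one value of `W`. -/
def commonGain (r : 𝒰 → 𝒱 → Fin 2 → ℝ) : ℝ :=
  ∑ u, rowGain (r u) - ∑ v, outEnt (∑ u, r u v 1) (∑ u, r u v 0)

variable [DecidableEq 𝒰] [DecidableEq 𝒱] [DecidableEq 𝒲]

/-- H(U,W), H(V,W) and H(W) cancel. The first bound becomes H(Y₁) + H(Y₂,W) + H(U,V,W) - H(U,W,Y₁) -
H(V,W,Y₂), where all terms but H(Y₁) are sums over w; the second is symmetric. -/
lemma sumBounds_eq (hq : IsBSSC q) (p : 𝒰 × 𝒱 × 𝒲 × Fin 2 → ℝ) :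
    sumBound₁ q p = (outEnt (law p (fun s => s.2.2.2) 0) (law p (fun s => s.2.2.2) 1) +
      ∑ w, (commonGain (fun u v x => p (u, v, w, x)) +
        outEnt (∑ u, ∑ v, p (u, v, w, 1)) (∑ u, ∑ v, p (u, v, w, 0)))) / Real.log 2 ∧
    sumBound₂ q p = (outEnt (law p (fun s => s.2.2.2) 1) (law p (fun s => s.2.2.2) 0) +
      ∑ w, (commonGain (fun u v x => p (u, v, w, x)) +
        outEnt (∑ u, ∑ v, p (u, v, w, 0)) (∑ u, ∑ v, p (u, v, w, 1)))) / Real.log 2 := by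
  have hUWY := hq.entropy_output₁ p (fun s => s.2.2.2) (fun s => (s.1, s.2.2.1))
  have hVWY := hq.entropy_output₂ p (fun s => s.2.2.2) (fun s => (s.2.1, s.2.2.1))
  have hWY₁ := hq.entropy_output₁ p (fun s => s.2.2.2) (fun s => s.2.2.1)
  have hWY₂ := hq.entropy_output₂ p (fun s => s.2.2.2) (fun s => s.2.2.1)
  have hUVW := hq.entropy_input p (fun s => s.2.2.2) (fun s => (s.1, s.2.1, s.2.2.1))
  have hY₁ := hq.entropy_fst p (fun s => s.2.2.2)
  have hY₂ := hq.entropy_snd p (fun s => s.2.2.2)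
  have eWY₁ := entropy_equiv (channelJoint p (fun s => s.2.2.2) q)
    (fun ω => (ω.1.2.2.1, ω.2.1)) (Equiv.prodComm _ _)
  have eWY₂ := entropy_equiv (channelJoint p (fun s => s.2.2.2) q)
    (fun ω => (ω.1.2.2.1, ω.2.2)) (Equiv.prodComm _ _)
  have eUWY := entropy_equiv (channelJoint p (fun s => s.2.2.2) q)
    (fun ω => ((ω.1.1, ω.1.2.2.1), ω.2.1))
    ((Equiv.prodAssoc _ _ _).trans ((Equiv.refl _).prodCongr (Equiv.prodComm _ _)))
  have eVWY := entropy_equiv (channelJoint p (fun s => s.2.2.2) q)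
    (fun ω => ((ω.1.2.1, ω.1.2.2.1), ω.2.2))
    ((Equiv.prodAssoc _ _ _).trans ((Equiv.refl _).prodCongr (Equiv.prodComm _ _)))
  simp only [Equiv.prodComm_apply, Prod.swap_prod_mk, Equiv.trans_apply, Equiv.prodAssoc_apply,
    Equiv.prodCongr_apply, Equiv.coe_refl, Prod.map_apply, id_eq] at eWY₁ eWY₂ eUWY eVWY
  simp only [Fintype.sum_prod_type, law_UWX, law_VWX, law_WX, law_UVW] at hUWY hVWY hWY₁ hWY₂ hUVW
  have s1 : ∑ w, commonGain (fun u v x => p (u, v, w, x)) =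
      ∑ u, ∑ v, ∑ w, Real.negMulLog (p (u, v, w, 0) + p (u, v, w, 1)) -
      ∑ u, ∑ w, outEnt (∑ v, p (u, v, w, 0)) (∑ v, p (u, v, w, 1)) -
      ∑ v, ∑ w, outEnt (∑ u, p (u, v, w, 1)) (∑ u, p (u, v, w, 0)) := by
    simp only [commonGain, rowGain, Finset.sum_sub_distrib]
    congr 1
    · congr 1
      · rw [Finset.sum_comm]
        exact Finset.sum_congr rfl fun u _ => Finset.sum_comm
      · exact Finset.sum_comm
    · exact Finset.sum_comm
  constructor
  · rw [Finset.sum_add_distrib, s1]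
    unfold sumBound₁ mutualInfo condMutualInfo martonJoint
    rw [eVWY, eWY₂, hUWY, hVWY, hWY₂, hUVW, hY₁]
    ring
  · rw [Finset.sum_add_distrib, s1]
    unfold sumBound₂ mutualInfo condMutualInfo martonJoint
    rw [eUWY, eWY₁, hUWY, hVWY, hWY₁, hUVW, hY₂]
    ring

/-- The minimum is at most the average, and the sum of the two bounds contains exactly one
`pairGain` for each w. -/
lemma two_mul_martonSumRate_le (hq : IsBSSC q) (p : 𝒰 × 𝒱 × 𝒲 × Fin 2 → ℝ)
    (hp : p ∈ stdSimplex ℝ (𝒰 × 𝒱 × 𝒲 × Fin 2)) :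
    2 * martonSumRate q p ≤
      mutualInfo (martonJoint q p) (fun ω => ω.1.2.2.2) (fun ω => ω.2.1)
        + mutualInfo (martonJoint q p) (fun ω => ω.1.2.2.2) (fun ω => ω.2.2)
        + gapMax / Real.log 2 := by
  have hl : 0 < Real.log 2 := Real.log_pos one_lt_two
  obtain ⟨h1, h2⟩ := sumBounds_eq hq p
  have i1 := hq.mutualInfo_fst p (fun s => s.2.2.2)
  have i2 := hq.mutualInfo_snd p (fun s => s.2.2.2)
  have hm : martonSumRate q p ≤ (sumBound₁ q p + sumBound₂ q p) / 2 := by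
    unfold martonSumRate
    linarith [min_le_left (sumBound₁ q p) (sumBound₂ q p),
      min_le_right (sumBound₁ q p) (sumBound₂ q p)]
  have hk := Finset.sum_le_sum fun w (_ : w ∈ (univ : Finset 𝒲)) =>
    pairGain_le (fun u v x => p (u, v, w, x)) fun u v x => hp.1 _
  have hx : law p (fun s => s.2.2.2) 0 + law p (fun s => s.2.2.2) 1 = 1 := by
    rw [← Fin.sum_univ_two (fun x => law p (fun s => s.2.2.2) x), sum_law, hp.2]
  simp only [pairGain, Finset.sum_add_distrib, Finset.sum_sub_distrib, ← Finset.mul_sum, ← Finset.sum_mul,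
    ← law_X, hx] at hk
  have e : sumBound₁ q p + sumBound₂ q p ≤
      (outEnt (law p (fun s => s.2.2.2) 0) (law p (fun s => s.2.2.2) 1) +
      outEnt (law p (fun s => s.2.2.2) 1) (law p (fun s => s.2.2.2) 0) - Real.log 2 + gapMax) /
        Real.log 2 := by
    rw [h1, h2, ← add_div]
    refine div_le_div_of_nonneg_right ?_ hl.le
    simp only [commonGain, Finset.sum_add_distrib, Finset.sum_sub_distrib]
    linarith
  have e' : (outEnt (law p (fun s => s.2.2.2) 0) (law p (fun s => s.2.2.2) 1) +
      outEnt (law p (fun s => s.2.2.2) 1) (law p (fun s => s.2.2.2) 0) - Real.log 2 + gapMax) /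
        Real.log 2 = mutualInfo (martonJoint q p) (fun ω => ω.1.2.2.2) (fun ω => ω.2.1)
        + mutualInfo (martonJoint q p) (fun ω => ω.1.2.2.2) (fun ω => ω.2.2)
        + gapMax / Real.log 2 := by
    unfold martonJoint
    rw [i1, i2, ← add_div, ← add_div]
    congr 1
    linear_combination Real.log 2 * hx
  linarith

end Marton

/-! ### Extrema over the input distribution -/

lemma outEnt_one_sub (x : ℝ) : outEnt x (1 - x) = Real.binEntropy (x / 2) := by
  rw [Real.binEntropy_eq_negMulLog_add_negMulLog_one_sub, outEnt]
  congr 2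
  ring

/-- Strict concavity of binary entropy at x/2 and (1-x)/2, whose midpoint is 1/4. -/
lemma outEnt_add_lt {x : ℝ} (h0 : 0 ≤ x) (h1 : x ≤ 1) (h : x ≠ 1 / 2) :
    outEnt x (1 - x) + outEnt (1 - x) x < 2 * outEnt (1 / 2) (1 / 2) := by
  have e : outEnt (1 - x) x = Real.binEntropy ((1 - x) / 2) := by
    rw [← outEnt_one_sub, sub_sub_cancel]
  have e' : outEnt (1 / 2) (1 / 2) = Real.binEntropy (1 / 4) := by
    have := outEnt_one_sub (1 / 2)
    norm_num at this ⊢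
    exact this
  rw [e, e', outEnt_one_sub]
  have hx : x / 2 ∈ Set.Icc (0 : ℝ) 1 := ⟨by linarith, by linarith⟩
  have hy : (1 - x) / 2 ∈ Set.Icc (0 : ℝ) 1 := ⟨by linarith, by linarith⟩
  have := Real.strictConcave_binEntropy.2 hx hy (fun hc => h (by linarith))
    (one_half_pos (α := ℝ)) (one_half_pos (α := ℝ)) (add_halves 1)
  simp only [smul_eq_mul] at this
  rw [show 1 / 2 * (x / 2) + 1 / 2 * ((1 - x) / 2) = (1 / 4 : ℝ) by ring] at this
  linarith

lemma outEnt_half_half : outEnt (1 / 2) (1 / 2) = 2 * Real.log 2 - 3 / 4 * Real.log 3 := by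
  unfold outEnt Real.negMulLog
  rw [show (1 : ℝ) / 2 / 2 = 1 / 2 ^ 2 by norm_num,
    show (1 : ℝ) / 2 ^ 2 + 1 / 2 = 3 / 2 ^ 2 by norm_num, Real.log_div (by norm_num) (by norm_num),
    Real.log_div (by norm_num) (by norm_num), Real.log_pow, Real.log_one]
  push_cast
  ring

/-- The maximum of `I(X;Y₁) - I(X;Y₂)`, in bits. -/
def maxDiff : ℝ := gapMax / Real.log 2

/-- The maximum of `I(X;Y₁) + I(X;Y₂)`, in bits. -/
def maxSum : ℝ := (2 * outEnt (1 / 2) (1 / 2) - Real.log 2) / Real.log 2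

lemma maxDiff_bounds : 0.100729516 < maxDiff ∧ maxDiff < 0.100729524 := by
  have hl : 0 < Real.log 2 := Real.log_pos one_lt_two
  have l1 := Real.log_two_gt_d9
  have l2 := Real.log_two_lt_d9
  obtain ⟨g1, g2⟩ := gapMax_bounds
  unfold maxDiff
  rw [lt_div_iff₀ hl, div_lt_iff₀ hl]
  norm_num at *
  constructor <;> linarith

lemma maxSum_bounds : 0.622556245 < maxSum ∧ maxSum < 0.622556255 := by
  have hl : 0 < Real.log 2 := Real.log_pos one_lt_two
  have l1 := Real.log_two_gt_d9
  have l2 := Real.log_two_lt_d9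
  have l3 := Real.log_three_gt_d9
  have l4 := Real.log_three_lt_d9
  unfold maxSum
  rw [outEnt_half_half, lt_div_iff₀ hl, div_lt_iff₀ hl]
  norm_num at *
  constructor <;> linarith

lemma coords_of_mem_stdSimplex {p : Fin 2 → ℝ} (hp : p ∈ stdSimplex ℝ (Fin 2)) :
    0 ≤ p 0 ∧ p 0 ≤ 1 ∧ p 1 = 1 - p 0 := by
  have h := hp.2
  rw [Fin.sum_univ_two] at h
  exact ⟨hp.1 0, by linarith [hp.1 1], by linarith⟩

lemma cons_mem_stdSimplex {x : ℝ} (h0 : 0 ≤ x) (h1 : x ≤ 1) :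
    ![x, 1 - x] ∈ stdSimplex ℝ (Fin 2) :=
  ⟨by simp [Fin.forall_fin_two, h0, h1], by simp⟩

namespace IsBSSC

variable {q : Fin 2 → Fin 2 × Fin 2 → ℝ}

lemma inputInfo_sub (hq : IsBSSC q) {p : Fin 2 → ℝ} (hp : p ∈ stdSimplex ℝ (Fin 2)) :
    inputInfo₁ q p - inputInfo₂ q p = infoGap (p 0) (1 - p 0) / Real.log 2 := by
  rw [hq.inputInfo₁_eq, hq.inputInfo₂_eq, (coords_of_mem_stdSimplex hp).2.2, ← sub_div, infoGap]
  ring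

lemma inputInfo_add (hq : IsBSSC q) {p : Fin 2 → ℝ} (hp : p ∈ stdSimplex ℝ (Fin 2)) :
    inputInfo₁ q p + inputInfo₂ q p =
      (outEnt (p 0) (1 - p 0) + outEnt (1 - p 0) (p 0) - Real.log 2) / Real.log 2 := by
  rw [hq.inputInfo₁_eq, hq.inputInfo₂_eq, (coords_of_mem_stdSimplex hp).2.2, ← add_div]
  ring

lemma inputInfo_sub_eq_iff (hq : IsBSSC q) {p : Fin 2 → ℝ} (hp : p ∈ stdSimplex ℝ (Fin 2)) :
    inputInfo₁ q p - inputInfo₂ q p ≤ maxDiff ∧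
      (inputInfo₁ q p - inputInfo₂ q p = maxDiff ↔ p 0 = gapArg) := by
  have hl : 0 < Real.log 2 := Real.log_pos one_lt_two
  obtain ⟨h0, h1, -⟩ := coords_of_mem_stdSimplex hp
  rw [hq.inputInfo_sub hp, maxDiff]
  by_cases h : p 0 = gapArg
  · simp [h, gapMax]
  have : infoGap (p 0) (1 - p 0) < gapMax := by
    rcases le_total (p 0) (1 / 2) with h2 | h2
    · exact infoGap_lt_gapMax h0 h2 h
    · exact (infoGap_nonpos (by linarith) (by linarith)).trans_lt gapMax_pos
  have := (div_lt_div_iff_of_pos_right hl).2 this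
  exact ⟨this.le, iff_of_false this.ne h⟩

lemma inputInfo_add_eq_iff (hq : IsBSSC q) {p : Fin 2 → ℝ} (hp : p ∈ stdSimplex ℝ (Fin 2)) :
    inputInfo₁ q p + inputInfo₂ q p ≤ maxSum ∧
      (inputInfo₁ q p + inputInfo₂ q p = maxSum ↔ p 0 = 1 / 2) := by
  have hl : 0 < Real.log 2 := Real.log_pos one_lt_two
  obtain ⟨h0, h1, -⟩ := coords_of_mem_stdSimplex hp
  rw [hq.inputInfo_add hp, maxSum]
  by_cases h : p 0 = 1 / 2
  · rw [h, show (1 : ℝ) - 1 / 2 = 1 / 2 by norm_num, two_mul]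
    simp
  have := outEnt_add_lt h0 h1 h
  have := (div_lt_div_iff_of_pos_right hl).2 (sub_lt_sub_right this (Real.log 2))
  exact ⟨this.le, iff_of_false this.ne h⟩

end IsBSSC

/-! ### The optimal distribution -/

/-- The maximising distribution: `W` is uniform, `P(X=0|W=0) = x`, `P(X=0|W=1) = 1 - x`, and
`(U, V) = (X, 0)` if `W = 0`, `(U, V) = (0, X)` if `W = 1`. -/
def optimalJoint (x : ℝ) : Fin 2 × Fin 2 × Fin 2 × Fin 2 → ℝ := fun s =>
  if (s.2.2.1 = 0 ∧ s.1 = s.2.2.2 ∧ s.2.1 = 0) ∨ (s.2.2.1 = 1 ∧ s.1 = 0 ∧ s.2.1 = s.2.2.2) then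
    if s.2.2.1 = s.2.2.2 then x / 2 else (1 - x) / 2 else 0

lemma optimalJoint_mem {x : ℝ} (h0 : 0 ≤ x) (h1 : x ≤ 1) :
    optimalJoint x ∈ stdSimplex ℝ (Fin 2 × Fin 2 × Fin 2 × Fin 2) := by
  constructor
  · intro s
    unfold optimalJoint
    split_ifs <;> linarith
  · simp [optimalJoint, Fintype.sum_prod_type, Fin.sum_univ_two]
    ring

lemma law_optimalJoint_X (x : ℝ) (i : Fin 2) :
    law (optimalJoint x) (fun s => s.2.2.2) i = 1 / 2 := by
  fin_cases i <;> simp [law, optimalJoint, Fintype.sum_prod_type, Fin.sum_univ_two] <;> ring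

variable {q : Fin 2 → Fin 2 × Fin 2 → ℝ}

/-- The two values agree because the distribution is invariant under exchanging the receivers. -/
lemma sumBounds_optimalJoint (hq : IsBSSC q) (x : ℝ) :
    sumBound₁ q (optimalJoint x) = (outEnt (1 / 2) (1 / 2) - Real.log 2 / 2 +
      infoGap (x / 2) ((1 - x) / 2)) / Real.log 2 ∧
    sumBound₂ q (optimalJoint x) = (outEnt (1 / 2) (1 / 2) - Real.log 2 / 2 +
      infoGap (x / 2) ((1 - x) / 2)) / Real.log 2 := by
  obtain ⟨h1, h2⟩ := sumBounds_eq hq (optimalJoint x)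
  rw [h1, h2, law_optimalJoint_X, law_optimalJoint_X]
  constructor <;> congr 1 <;>
    simp [optimalJoint, Fin.sum_univ_two, commonGain, rowGain, IsBSSC.outEnt_zero_left,
      IsBSSC.outEnt_zero_right, infoGap] <;> ring

lemma mutualInfo_optimalJoint (hq : IsBSSC q) (x : ℝ) :
    mutualInfo (martonJoint q (optimalJoint x)) (fun ω => (ω.1.1, ω.1.2.2.1)) (fun ω => ω.2.1) =
      (outEnt (1 / 2) (1 / 2) + (1 - x) / 2 * Real.log 2 - outEnt ((1 - x) / 2) (x / 2)) /
        Real.log 2 ∧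
    mutualInfo (martonJoint q (optimalJoint x)) (fun ω => (ω.1.2.1, ω.1.2.2.1)) (fun ω => ω.2.2) =
      (outEnt (1 / 2) (1 / 2) + (1 - x) / 2 * Real.log 2 - outEnt ((1 - x) / 2) (x / 2)) /
        Real.log 2 := by
  have hUWY := hq.entropy_output₁ (optimalJoint x) (fun s => s.2.2.2) (fun s => (s.1, s.2.2.1))
  have hVWY := hq.entropy_output₂ (optimalJoint x) (fun s => s.2.2.2) (fun s => (s.2.1, s.2.2.1))
  have hUW := hq.entropy_input (optimalJoint x) (fun s => s.2.2.2) (fun s => (s.1, s.2.2.1))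
  have hVW := hq.entropy_input (optimalJoint x) (fun s => s.2.2.2) (fun s => (s.2.1, s.2.2.1))
  have hY₁ := hq.entropy_fst (optimalJoint x) (fun s => s.2.2.2)
  have hY₂ := hq.entropy_snd (optimalJoint x) (fun s => s.2.2.2)
  rw [law_optimalJoint_X, law_optimalJoint_X] at hY₁ hY₂
  have hh : Real.negMulLog ((1 - x) / 2 + x / 2) = Real.log 2 / 2 := by
    rw [show (1 - x) / 2 + x / 2 = 1 / 2 by ring, negMulLog_half]
    simp; ring
  have hh' : Real.negMulLog (x / 2 + (1 - x) / 2) = Real.log 2 / 2 := by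
    rw [add_comm, hh]
  unfold mutualInfo martonJoint
  rw [hUWY, hVWY, hUW, hVW, hY₁, hY₂, ← add_div, ← add_div, ← sub_div, ← sub_div]
  constructor <;> congr 1 <;>
    simp [law, Fintype.sum_prod_type, optimalJoint, Fin.sum_univ_two, IsBSSC.outEnt_zero_left,
      IsBSSC.outEnt_zero_right, hh, hh'] <;> ring

lemma optimalJoint_sumRate (hq : IsBSSC q) :
    sumBound₁ q (optimalJoint gapArg) = (maxSum + maxDiff) / 2 ∧
      sumBound₂ q (optimalJoint gapArg) = (maxSum + maxDiff) / 2 := by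
  obtain ⟨h1, h2⟩ := sumBounds_optimalJoint hq gapArg
  have e : infoGap (gapArg / 2) ((1 - gapArg) / 2) = gapMax / 2 := by
    have := infoGap_mul (1 / 2) gapArg (1 - gapArg)
    rw [gapMax, div_eq_inv_mul, div_eq_inv_mul, div_eq_inv_mul, ← one_div, this]
  rw [h1, h2, e, maxSum, maxDiff]
  constructor <;> ring

/-- Makes the equal split R₁ = R₂ admissible. Once expanded, it says that I(X;Y₁)+I(X;Y₂) at
`gapArg` does not exceed its value at 1/2. -/
lemma half_sumRate_le_mutualInfo :
    (maxSum + maxDiff) / 4 ≤ (outEnt (1 / 2) (1 / 2) + (1 - gapArg) / 2 * Real.log 2 -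
      outEnt ((1 - gapArg) / 2) (gapArg / 2)) / Real.log 2 := by
  have hl : 0 < Real.log 2 := Real.log_pos one_lt_two
  obtain ⟨g0, g1⟩ := gapArg_bounds
  norm_num at g0 g1
  have h := outEnt_add_lt (x := gapArg) (by linarith) (by linarith) (by linarith)
  have e := outEnt_mul (1 / 2) (1 - gapArg) gapArg
  have n : Real.negMulLog (1 / 2) = Real.log 2 / 2 := by
    rw [negMulLog_half]; simp; ring
  rw [n, one_div_mul_eq_div, one_div_mul_eq_div] at e
  rw [maxSum, maxDiff, ← add_div, div_div, mul_comm (Real.log 2), ← div_div]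
  refine div_le_div_of_nonneg_right ?_ hl.le
  rw [e, gapMax, infoGap]
  linarith

end Evaluation

/-! ### Assembly -/

theorem mainTheorem5 (q : Fin 2 → Fin 2 × Fin 2 → ℝ) (hq : IsBSSC q) :
    ∃ d x₀ m : ℝ,
      -- `d` is the maximum of `I(X;Y₁) - I(X;Y₂)`, attained exactly when `P(X=0) = x₀`
      IsGreatest ((fun p => inputInfo₁ q p - inputInfo₂ q p) '' stdSimplex ℝ (Fin 2)) d ∧
      (∀ p ∈ stdSimplex ℝ (Fin 2), inputInfo₁ q p - inputInfo₂ q p = d ↔ p 0 = x₀) ∧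
      |d - 0.10072952| < 5 / 10 ^ 9 ∧
      0.15843497 < x₀ ∧ x₀ < 0.15843498 ∧
      -- `m` is the maximum of `I(X;Y₁) + I(X;Y₂)`, attained exactly when `P(X=0) = 1/2`
      IsGreatest ((fun p => inputInfo₁ q p + inputInfo₂ q p) '' stdSimplex ℝ (Fin 2)) m ∧
      (∀ p ∈ stdSimplex ℝ (Fin 2), inputInfo₁ q p + inputInfo₂ q p = m ↔ p 0 = 1 / 2) ∧
      0.6225562 < m ∧ m < 0.6225563 ∧
      -- `2 SR ≤ I(X;Y₁) + I(X;Y₂) + d` for every distribution of `(U, V, W, X)`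
      (∀ (a b c : ℕ) (p : Fin a × Fin b × Fin c × Fin 2 → ℝ),
        p ∈ stdSimplex ℝ (Fin a × Fin b × Fin c × Fin 2) →
        2 * martonSumRate q p ≤
          mutualInfo (martonJoint q p) (fun ω => ω.1.2.2.2) (fun ω => ω.2.1)
            + mutualInfo (martonJoint q p) (fun ω => ω.1.2.2.2) (fun ω => ω.2.2) + d) ∧
      -- the maximum sum-rate of Marton's region is `(m + d) / 2 = 0.36164288...`
      IsGreatest ((fun R : ℝ × ℝ => R.1 + R.2) '' martonRegion q) ((m + d) / 2) ∧
      0.36164288 < (m + d) / 2 ∧ (m + d) / 2 < 0.36164289 ∧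
      -- it is attained with a uniform binary `W`, `P(X=0|W=0) = x₀` and `P(X=0|W=1) = 1 - x₀`
      ∃ (a b : ℕ) (p : Fin a × Fin b × Fin 2 × Fin 2 → ℝ),
        p ∈ stdSimplex ℝ (Fin a × Fin b × Fin 2 × Fin 2) ∧
        law p (fun s => s.2.2) (0, 0) = 1 / 2 * x₀ ∧
        law p (fun s => s.2.2) (0, 1) = 1 / 2 * (1 - x₀) ∧
        law p (fun s => s.2.2) (1, 0) = 1 / 2 * (1 - x₀) ∧
        law p (fun s => s.2.2) (1, 1) = 1 / 2 * x₀ ∧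
        martonSumRate q p = (m + d) / 2 ∧
        ∃ R ∈ martonRates q p, R.1 + R.2 = (m + d) / 2 := by
  obtain ⟨g0, g1⟩ := gapArg_bounds
  obtain ⟨d0, d1⟩ := maxDiff_bounds
  obtain ⟨m0, m1⟩ := maxSum_bounds
  norm_num at g0 g1 d0 d1 m0 m1
  have hgm := cons_mem_stdSimplex (x := gapArg) (by linarith) (by linarith)
  have hhm := cons_mem_stdSimplex (x := 1 / 2) (by norm_num) (by norm_num)
  have hpm := optimalJoint_mem (x := gapArg) (by linarith) (by linarith)
  obtain ⟨s1, s2⟩ := optimalJoint_sumRate hq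
  obtain ⟨i1, i2⟩ := mutualInfo_optimalJoint hq gapArg
  have hrate : ((maxSum + maxDiff) / 4, (maxSum + maxDiff) / 4) ∈
      martonRates q (optimalJoint gapArg) := by
    refine ⟨by dsimp only; linarith, by dsimp only; linarith, ?_, ?_, ?_, ?_⟩
    · rw [i1]; exact half_sumRate_le_mutualInfo
    · rw [i2]; exact half_sumRate_le_mutualInfo
    · rw [s1]; dsimp only; linarith
    · rw [s2]; dsimp only; linarith
  refine ⟨maxDiff, gapArg, maxSum, ⟨⟨_, hgm, (hq.inputInfo_sub_eq_iff hgm).2.2 (by simp)⟩, ?_⟩,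
    fun p hp => (hq.inputInfo_sub_eq_iff hp).2, ?_, by norm_num; linarith, by norm_num; linarith,
    ⟨⟨_, hhm, (hq.inputInfo_add_eq_iff hhm).2.2 (by simp)⟩, ?_⟩,
    fun p hp => (hq.inputInfo_add_eq_iff hp).2, by norm_num; linarith, by norm_num; linarith,
    fun a b c p hp => two_mul_martonSumRate_le hq p hp,
    ⟨⟨_, ⟨2, 2, 2, _, hpm, hrate⟩, by ring⟩, ?_⟩, by norm_num; linarith, by norm_num; linarith,
    2, 2, optimalJoint gapArg, hpm, ?_, ?_, ?_, ?_, by rw [martonSumRate, s1, s2, min_self],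
    _, hrate, by ring⟩
  · rintro _ ⟨p, hp, rfl⟩
    exact (hq.inputInfo_sub_eq_iff hp).1
  · rw [abs_lt]
    norm_num
    constructor <;> linarith
  · rintro _ ⟨p, hp, rfl⟩
    exact (hq.inputInfo_add_eq_iff hp).1
  · rintro _ ⟨R, ⟨a, b, c, p, hp, hR⟩, rfl⟩
    have h := two_mul_martonSumRate_le hq p hp
    have h' : R.1 + R.2 ≤ martonSumRate q p := le_min hR.2.2.2.2.1 hR.2.2.2.2.2
    -- The law of X is an input distribution, so `maxSum` bounds the first two terms of the
    -- converse.
    have hX : (fun x => law p (fun s => s.2.2.2) x) ∈ stdSimplex ℝ (Fin 2) :=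
      ⟨fun x => Finset.sum_nonneg fun s _ => by split_ifs; exacts [hp.1 s, le_rfl],
        by rw [sum_law, hp.2]⟩
    have hm := (hq.inputInfo_add_eq_iff hX).1
    rw [hq.inputInfo₁_eq, hq.inputInfo₂_eq] at hm
    unfold martonJoint at h
    rw [hq.mutualInfo_fst p (fun s => s.2.2.2), hq.mutualInfo_snd p (fun s => s.2.2.2)] at h
    dsimp only
    rw [maxDiff]
    linarith
  all_goals
    simp [law, optimalJoint, Fintype.sum_prod_type, Fin.sum_univ_two]
    ring

end
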